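/- Conventions. Simplicial complexes are finite and contain the empty simplex. A complex is \emph{flag} if every set of vertices that are pairwise joined by edges is a simplex. $\mathrm{Lk}_\sigma(X)=\{\tau\in X: \sigma\cap\tau=\emptyset,\ \sigma\cup\tau\in X\}$, the join is $X*Y=\{\sigma\sqcup\tau:\sigma\in X,\tau\in Y\}$, and for an edge $\eta=\{s,t\}$ and a new vertex $e$ the subdivision of $X$ along $\eta$ is $$\mathrm{Sub}_\eta(X)=\{\sigma\in X:\eta\not\subset\sigma\}\cup\{\sigma\cup\{e\},\ \sigma\cup\{s,e\},\ \sigma\cup\{t,e\}:\sigma\in\mathrm{Lk}_\eta(X)\}.$$ The $m$-gon is the cyclic triangulation of the circle with $m$ vertices (pentagon: $m=5$, quadrilateral: $m=4$), and the cross-polytope $O^n$ is the $n$-fold join of $S^0$ (two points). A \emph{triangulation of $S^n$} is a complex whose geometric realization is homeomorphic to $S^n$; it is \emph{convex} if it can be realized as the boundary complex of an $(n+1)$-dimensional convex polytope. For $X$ of dimension $n-1$ put $f_X(t)=\sum_{\sigma\in X}t^{\#\sigma}$ and define $h_X$ by $(1+t)^n h_X\left(\frac1{1+t}\right)=t^n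 f_X\left(\frac1t\right)$, and $\gamma_X$ (of degree at most $\frac12\deg h_X$) by $h_X(t)=(1+t)^{\deg h_X}\gamma_X\left(\frac{t}{(1+t)^2}\right)$. Statement. Let $X_1$ be the join of two pentagons. Then $X_1$ has an edge whose link is isomorphic to a quadrilateral. For every such edge $\eta$, let $X_2=\mathrm{Sub}_\eta(X_1)$ and let $X$ be the join of $X_2$ with a pentagon. Then: (1) $X$ is a convex flag triangulation of $S^5$ and $\gamma_X(t)=1+4t+4t^2+t^3$. (2) $X$ has an edge whose link is isomorphic to the cross-polytope $O^4$. For every such edge $\theta$, the complex $X'=\mathrm{Sub}_\theta(X)$ is a convex flag triangulation of $S^5$, its $f$-polynomial is $1+17t+109t^2+345t^3+575t^4+483t^5+161t^6$, and $h_{X'}$ has a non-real root. Moreover $X'$ again has an edge whose link is isomorphic to $O^4$, and for every such edge $\kappa$ of $X'$, $\mathrm{Sub}_\kappa(X')$ is a convex flag triangulation of $S^5$ whose $h$-polynomial has a non-real root. (3) For every such $X'$, every $k\ge 0$ and every flag triangulation $Y$ of $S^k$, the join $X'*Y$ is a flag triangulation of $S^{k+6}$ whose $h$-polynomial has a non-real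 root; if $Y$ is convex, then so is $X'*Y$. (4) For every $n\ge5$ there is a convex flag triangulation of $S^n$ whose $h$-polynomial has a non-real root. -/

import Mathlib

open Polynomial

namespace PreAbstractSimplicialComplex

variable {V W : Type*}

/-- The simplices of `K`, the empty one included. (The field `faces` lists the nonempty ones.) -/
def IsSimplex (K : PreAbstractSimplicialComplex V) (σ : Finset V) : Prop :=
  σ = ∅ ∨ σ ∈ K.faces

theorem IsSimplex.mono {K : PreAbstractSimplicialComplex V} {σ τ : Finset V}
    (h : K.IsSimplex σ) (hτ : τ ⊆ σ) : K.IsSimplex τ := by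
  rcases τ.eq_empty_or_nonempty with rfl | hne
  · exact Or.inl rfl
  · rcases h with rfl | h
    · exact Or.inl (Finset.subset_empty.mp hτ)
    · exact Or.inr ((K.isRelLowerSet_faces h).2 hτ hne)

/-- The complex whose nonempty simplices are the nonempty members of a family of finite sets that
is closed under passing to subsets. -/
def ofSimplices (P : Finset V → Prop) (hP : ∀ σ τ, P σ → τ ⊆ σ → P τ) :
    PreAbstractSimplicialComplex V where
  faces := {σ | σ.Nonempty ∧ P σ}
  isRelLowerSet_faces := fun _ hσ => ⟨hσ.1, fun _ hτ hne => ⟨hne, hP _ _ hσ.2 hτ⟩⟩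

/-- An edge is a face with exactly two vertices. -/
def IsEdge (K : PreAbstractSimplicialComplex V) (η : Finset V) : Prop :=
  η ∈ K.faces ∧ η.card = 2

/-- A complex is flag if every finite set of vertices, any two distinct ones of which are joined by
an edge, is a simplex. -/
def IsFlag [DecidableEq V] (K : PreAbstractSimplicialComplex V) : Prop :=
  ∀ T : Finset V, (∀ v ∈ T, {v} ∈ K.faces) →
    (∀ v ∈ T, ∀ w ∈ T, v ≠ w → K.IsEdge {v, w}) → K.IsSimplex T

/-- The link of a simplex `σ`: all `τ` with `σ ∪ τ ∈ K` and `σ ∩ τ = ∅`. -/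
def link [DecidableEq V] (K : PreAbstractSimplicialComplex V) (σ : Finset V) :
    PreAbstractSimplicialComplex V where
  faces := {τ | τ.Nonempty ∧ Disjoint σ τ ∧ σ ∪ τ ∈ K.faces}
  isRelLowerSet_faces := fun _ hτ => ⟨hτ.1, fun _ hρ hne =>
    ⟨hne, Finset.disjoint_of_subset_right hρ hτ.2.1,
      (K.isRelLowerSet_faces hτ.2.2).2 (Finset.union_subset_union_right hρ)
        (hne.mono Finset.subset_union_right)⟩⟩

/-- The join of two complexes, on the disjoint union of their vertex sets. -/
def join (K : PreAbstractSimplicialComplex V) (L : PreAbstractSimplicialComplex W) :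
    PreAbstractSimplicialComplex (V ⊕ W) :=
  ofSimplices (fun ρ => K.IsSimplex ρ.toLeft ∧ L.IsSimplex ρ.toRight) fun _ _ h hτ =>
    ⟨h.1.mono (Finset.toLeft_subset_toLeft hτ), h.2.mono (Finset.toRight_subset_toRight hτ)⟩

/-- The subdivision `Sub_η(K)` of `K` along `η`, with the new vertex `e = none`. Its simplices are
the simplices of `K` that do not contain `η`, and the sets `σ ∪ ζ ∪ {e}` with `σ` in the link of `η`
and `ζ` a proper subset of `η`; if `η = {s, t}` is an edge, `ζ` is one of `∅`, `{s}`, `{t}`. -/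
def subdivide [DecidableEq V] (K : PreAbstractSimplicialComplex V) (η : Finset V) :
    PreAbstractSimplicialComplex (Option V) where
  faces := {ρ | (∃ σ ∈ K.faces, ¬ η ⊆ σ ∧ ρ = σ.map Function.Embedding.some) ∨
    ∃ σ ζ : Finset V, (Disjoint η σ ∧ η ∪ σ ∈ K.faces) ∧ ζ ⊂ η ∧
      ρ = insert none ((σ ∪ ζ).map Function.Embedding.some)}
  isRelLowerSet_faces := by
    have key : ∀ ρ : Finset (Option V), none ∉ ρ →
        ρ = ρ.eraseNone.map Function.Embedding.some := by
      intro ρ h; ext (_ | x) <;> simp [h]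
    have key' : ∀ ρ : Finset (Option V), none ∈ ρ →
        ρ = insert none (ρ.eraseNone.map Function.Embedding.some) := by
      intro ρ h; ext (_ | x) <;> simp [h]
    rintro ρ (⟨σ, hσ, hη, rfl⟩ | ⟨σ, ζ, ⟨hd, hσ⟩, hζ, rfl⟩)
    · refine ⟨(K.isRelLowerSet_faces hσ).1.map, fun τ hτ hne => Or.inl ?_⟩
      obtain ⟨σ', hσ', rfl⟩ := Finset.subset_map_iff.mp hτ
      exact ⟨σ', (K.isRelLowerSet_faces hσ).2 hσ' (by simpa using hne),
        fun h => hη (h.trans hσ'), rfl⟩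
    · have hη : η.Nonempty := let ⟨x, hx, _⟩ := Finset.exists_of_ssubset hζ; ⟨x, hx⟩
      refine ⟨⟨none, by simp⟩, fun τ hτ hne => ?_⟩
      have hsub : τ.eraseNone ⊆ σ ∪ ζ := by
        intro x hx
        have := hτ (Finset.mem_eraseNone.mp hx)
        simpa using this
      by_cases hn : none ∈ τ
      · right
        refine ⟨τ.eraseNone ∩ σ, τ.eraseNone ∩ ζ,
          ⟨Finset.disjoint_of_subset_right Finset.inter_subset_right hd, ?_⟩,
          lt_of_le_of_lt Finset.inter_subset_right hζ, ?_⟩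
        · exact (K.isRelLowerSet_faces hσ).2
            (Finset.union_subset_union_right Finset.inter_subset_right)
            (hη.mono Finset.subset_union_left)
        · rw [← Finset.inter_union_distrib_left, Finset.inter_eq_left.mpr hsub]
          exact key' τ hn
      · left
        refine ⟨τ.eraseNone, (K.isRelLowerSet_faces hσ).2 ?_ ?_, ?_, key τ hn⟩
        · intro x hx
          rcases Finset.mem_union.mp (hsub hx) with h | h
          · exact Finset.mem_union_right _ h
          · exact Finset.mem_union_left _ (hζ.1 h)
        · rw [key τ hn] at hne
          exact Finset.map_nonempty.mp hne
        · intro h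
          obtain ⟨x, hx, hx'⟩ := Finset.exists_of_ssubset hζ
          rcases Finset.mem_union.mp (hsub (h hx)) with h' | h'
          · exact Finset.disjoint_left.mp hd hx h'
          · exact hx' h'

/-- The `m`-gon, for `m ≥ 3`: vertices `0, …, m - 1` in cyclic order and edges `{i, i + 1}`. -/
def polygon (m : ℕ) : PreAbstractSimplicialComplex (ZMod m) :=
  ofSimplices (fun σ => ∃ i, σ ⊆ {i, i + 1}) fun _ _ ⟨i, h⟩ hτ => ⟨i, hτ.trans h⟩

/-- The zero-dimensional sphere: two points and no edge. -/
def zeroSphere : PreAbstractSimplicialComplex Bool :=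
  ofSimplices (fun σ => ∃ b, σ ⊆ {b}) fun _ _ ⟨b, h⟩ hτ => ⟨b, hτ.trans h⟩

/-- The (boundary of the) cross-polytope `O^n`, i.e. the `n`-fold join of the zero-dimensional
sphere: `σ` is a simplex if and only if its part in each of the `n` copies of that sphere is. -/
def crossPolytope (n : ℕ) : PreAbstractSimplicialComplex (Fin n × Bool) :=
  ofSimplices (fun σ => ∀ i, zeroSphere.IsSimplex (Finset.univ.filter fun b => (i, b) ∈ σ))
    fun _ _ h hτ i => (h i).mono (Finset.monotone_filter_right _ fun _ _ hb => hτ hb)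

/-- Isomorphism of complexes: a bijection between the vertex sets under which the faces
correspond. -/
def IsIsomorphic (K : PreAbstractSimplicialComplex V) (L : PreAbstractSimplicialComplex W) :
    Prop :=
  ∃ e : {v // {v} ∈ K.faces} ≃ {w // {w} ∈ L.faces}, ∀ σ : Finset {v // {v} ∈ K.faces},
    σ.map (Function.Embedding.subtype _) ∈ K.faces ↔
      (σ.map e.toEmbedding).map (Function.Embedding.subtype _) ∈ L.faces

open Classical in
/-- The f-polynomial `∑ t ^ #σ`, the sum being over all simplices, the empty one included. -/
noncomputable def fPoly [Fintype V] (K : PreAbstractSimplicialComplex V) : ℤ[X] :=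
  ∑ σ : Finset V with K.IsSimplex σ, X ^ σ.card

open Classical in
/-- The largest number of vertices of a simplex, i.e. the dimension plus one. -/
noncomputable def rank [Fintype V] (K : PreAbstractSimplicialComplex V) : ℕ :=
  (Finset.univ.filter fun σ : Finset V => K.IsSimplex σ).sup Finset.card

open Classical in
/-- The h-polynomial `∑ t ^ #σ * (1 - t) ^ (n - #σ)`, where `n - 1` is the dimension. It is the
polynomial determined by `(1 + t) ^ n * h (1 / (1 + t)) = t ^ n * f (1 / t)`. -/
noncomputable def hPoly [Fintype V] (K : PreAbstractSimplicialComplex V) : ℤ[X] :=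
  ∑ σ : Finset V with K.IsSimplex σ, X ^ σ.card * (1 - X) ^ (K.rank - σ.card)

theorem hPoly_spec [Fintype V] (K : PreAbstractSimplicialComplex V) (t : ℝ) (h0 : t ≠ 0)
    (h1 : 1 + t ≠ 0) :
    (1 + t) ^ K.rank * aeval (1 / (1 + t)) K.hPoly = t ^ K.rank * aeval (1 / t) K.fPoly := by
  classical
  simp only [hPoly, fPoly, map_sum, Finset.mul_sum]
  refine Finset.sum_congr rfl fun σ hσ => ?_
  obtain ⟨k, hk⟩ := Nat.exists_eq_add_of_le (show σ.card ≤ K.rank from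
    Finset.le_sup (f := Finset.card) (by simpa using hσ))
  simp only [map_mul, map_pow, map_sub, map_one, aeval_X]
  rw [show 1 - 1 / (1 + t) = t / (1 + t) by field_simp; ring, hk, Nat.add_sub_cancel_left]
  simp only [div_pow, one_pow, pow_add]
  field_simp

/-- `γ` is the γ-polynomial of `K`: its degree is at most half the degree of the h-polynomial `h`,
and `h(t) = (1 + t) ^ (deg h) * γ(t / (1 + t) ^ 2)`. -/
def IsGammaPoly [Fintype V] (K : PreAbstractSimplicialComplex V) (γ : ℤ[X]) : Prop :=
  2 * γ.natDegree ≤ K.hPoly.natDegree ∧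
  ∀ t : ℝ, 1 + t ≠ 0 →
    aeval t K.hPoly = (1 + t) ^ K.hPoly.natDegree * aeval (t / (1 + t) ^ 2) γ

/-- The h-polynomial has a root in `ℂ` that is not real. -/
def HasNonrealHRoot [Fintype V] (K : PreAbstractSimplicialComplex V) : Prop :=
  ∃ z : ℂ, aeval z K.hPoly = 0 ∧ z.im ≠ 0

/-- The geometric realization of a finite complex, in barycentric coordinates. -/
def realization [Fintype V] (K : PreAbstractSimplicialComplex V) : Set (V → ℝ) :=
  {x | x ∈ stdSimplex ℝ V ∧ ∃ σ ∈ K.faces, ∀ v, v ∉ σ → x v = 0}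

/-- `K` triangulates the `n`-sphere: its realization is homeomorphic to the unit sphere of
`ℝ ^ (n + 1)`. -/
def IsSphereTriangulation [Fintype V] (K : PreAbstractSimplicialComplex V) (n : ℕ) : Prop :=
  Nonempty (K.realization ≃ₜ Metric.sphere (0 : EuclideanSpace ℝ (Fin (n + 1))) 1)

/-- `K` is a convex triangulation of the `n`-sphere: the vertices can be placed in `ℝ ^ (n + 1)` as
the vertices of a full-dimensional convex polytope so that `K` becomes its boundary complex. That
is, all proper faces of the polytope are simplices, and the faces of `K` are exactly the vertex sets
of its nonempty proper faces, i.e. of its intersections with supporting hyperplanes `l = c`. -/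
def IsConvexSphereTriangulation [Fintype V] (K : PreAbstractSimplicialComplex V) (n : ℕ) : Prop :=
  ∃ p : V → EuclideanSpace ℝ (Fin (n + 1)),
    Function.Injective p ∧
    (interior (convexHull ℝ (Set.range p))).Nonempty ∧
    (convexHull ℝ (Set.range p)).extremePoints ℝ = Set.range p ∧
    (∀ σ : Finset V, σ ∈ K.faces ↔ σ.Nonempty ∧ σ ≠ Finset.univ ∧
      ∃ (l : EuclideanSpace ℝ (Fin (n + 1)) →L[ℝ] ℝ) (c : ℝ),
        ∀ v, l (p v) ≤ c ∧ (l (p v) = c ↔ v ∈ σ)) ∧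
    ∀ σ ∈ K.faces, AffineIndependent ℝ fun v : σ => p v

/-- `K` is a convex flag triangulation of the `n`-sphere. -/
def IsConvexFlagSphere [Fintype V] [DecidableEq V] (K : PreAbstractSimplicialComplex V) (n : ℕ) :
    Prop :=
  K.IsFlag ∧ K.IsSphereTriangulation n ∧ K.IsConvexSphereTriangulation n

end PreAbstractSimplicialComplex

/-!
The f-polynomial is multiplicative under joins, and subdividing an edge `η` adds
`t * (1 + t) * f_{Lk η}(t)` to it. The polynomials `1 + 5 t + 5 t ^ 2` of the pentagon and
`(1 + 2 t) ^ (2 k)` of the cross-polytope are polynomials in `u = t + t ^ 2`, so for all the spheres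
built from them `f = P(u)`; for `X'` and its subdivisions `P` is a cubic of negative discriminant,
which has a non-real root. A complex number `t` with `t + t ^ 2` not real is not real, and the roots
of `h` are the `t / (1 + t)` for the roots `t ≠ -1` of `f`, hence `h` has a non-real root.

Convexity is inherited because a polytope with the origin in its interior is described by the
functionals `l ≤ 1` that support it: joins are direct sums of polytopes, and subdividing `η` adds a
vertex slightly beyond the barycentre of the face `η`. For spheres that are not convex the join is
compared with a unit sphere of the `ℓ¹` norm on a product.
-/

namespace FlagSphere

open PreAbstractSimplicialComplex

section Simplices

variable {V W : Type*} {K : PreAbstractSimplicialComplex V} {L : PreAbstractSimplicialComplex W}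

theorem isSimplex_empty (K : PreAbstractSimplicialComplex V) : K.IsSimplex ∅ := Or.inl rfl

theorem mem_faces_iff {σ : Finset V} : σ ∈ K.faces ↔ σ.Nonempty ∧ K.IsSimplex σ := by
  refine ⟨fun h => ⟨(K.isRelLowerSet_faces h).1, Or.inr h⟩, ?_⟩
  rintro ⟨h, rfl | h'⟩
  · exact absurd h Finset.not_nonempty_empty
  · exact h'

theorem singleton_mem_faces_iff {v : V} : {v} ∈ K.faces ↔ K.IsSimplex {v} := by
  simp [mem_faces_iff]

theorem isSimplex_ofSimplices {P : Finset V → Prop} {hP : ∀ σ τ, P σ → τ ⊆ σ → P τ}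
    {σ : Finset V} : (ofSimplices P hP).IsSimplex σ ↔ σ = ∅ ∨ P σ := by
  rcases σ.eq_empty_or_nonempty with rfl | h
  · simp [isSimplex_empty]
  · simp [IsSimplex, ofSimplices, h]

theorem isSimplex_join {ρ : Finset (V ⊕ W)} :
    (K.join L).IsSimplex ρ ↔ K.IsSimplex ρ.toLeft ∧ L.IsSimplex ρ.toRight := by
  rw [join, isSimplex_ofSimplices, or_iff_right_iff_imp]
  rintro rfl
  exact ⟨isSimplex_empty K, isSimplex_empty L⟩

theorem isSimplex_link [DecidableEq V] {σ τ : Finset V} (hσ : K.IsSimplex σ) :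
    (K.link σ).IsSimplex τ ↔ Disjoint σ τ ∧ K.IsSimplex (σ ∪ τ) := by
  rcases τ.eq_empty_or_nonempty with rfl | h
  · simp [isSimplex_empty, hσ]
  · have hτ : (K.link σ).IsSimplex τ ↔ τ ∈ (K.link σ).faces := by simp [mem_faces_iff, h]
    rw [hτ]
    simp [link, h, mem_faces_iff]

theorem exists_eq_map_some_or_eq_insertNone (ρ : Finset (Option V)) :
    ∃ σ : Finset V, ρ = σ.map .some ∨ ρ = Finset.insertNone σ := by
  refine ⟨ρ.eraseNone, ?_⟩
  by_cases hρ : none ∈ ρ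
  · right; ext (_ | x) <;> simp [hρ]
  · left; ext (_ | x) <;> simp [hρ]

section Subdivide

variable [DecidableEq V] {η σ : Finset V}

theorem isSimplex_subdivide_map_some (hη : η.Nonempty) :
    (K.subdivide η).IsSimplex (σ.map .some) ↔ ¬ η ⊆ σ ∧ K.IsSimplex σ := by
  have hnone (τ : Finset (Option V)) : σ.map .some ≠ insert none τ := fun h =>
    absurd (h ▸ Finset.mem_insert_self none τ) (by simp)
  rcases σ.eq_empty_or_nonempty with rfl | hσ
  · simp [isSimplex_empty, Finset.subset_empty, hη.ne_empty]
  · simp [IsSimplex, subdivide, hnone, hσ.ne_empty, and_comm]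

theorem isSimplex_subdivide_insertNone :
    (K.subdivide η).IsSimplex (Finset.insertNone σ) ↔ ¬ η ⊆ σ ∧ K.IsSimplex (η ∪ σ) := by
  constructor
  · rintro (h | ⟨τ, -, -, h⟩ | ⟨τ, ζ, ⟨hd, hτ⟩, hζ, h⟩)
    · exact absurd h (Finset.insertNone_nonempty).ne_empty
    · exact absurd (h ▸ Finset.none_mem_insertNone) (by simp)
    · obtain rfl : σ = τ ∪ ζ := by
        ext x
        simpa using congrArg (some x ∈ ·) h
      refine ⟨fun hη => hζ.2 (Disjoint.left_le_of_le_sup_left hη hd), ?_⟩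
      rw [Finset.union_left_comm, Finset.union_eq_left.mpr hζ.1, Finset.union_comm]
      exact Or.inr hτ
  · rintro ⟨hησ, h⟩
    have hη : η.Nonempty := by
      rw [Finset.nonempty_iff_ne_empty]
      rintro rfl
      simp at hησ
    refine Or.inr (Or.inr ⟨σ \ η, η ∩ σ, ⟨Finset.disjoint_sdiff, ?_⟩, ?_, ?_⟩)
    · rw [Finset.union_sdiff_self_eq_union]
      exact mem_faces_iff.mpr ⟨hη.mono Finset.subset_union_left, h⟩
    · exact Finset.inter_subset_left.ssubset_of_ne fun h => hησ (Finset.inter_eq_left.mp h)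
    · rw [Finset.inter_comm, Finset.sdiff_union_inter]
      ext (_ | x) <;> simp

theorem isSimplex_subdivide (hη : η.Nonempty) {ρ : Finset (Option V)} :
    (K.subdivide η).IsSimplex ρ ↔ ¬ η ⊆ ρ.eraseNone ∧ K.IsSimplex ρ.eraseNone ∧
      (none ∈ ρ → K.IsSimplex (η ∪ ρ.eraseNone)) := by
  obtain ⟨σ, rfl | rfl⟩ := exists_eq_map_some_or_eq_insertNone ρ
  · simp [isSimplex_subdivide_map_some hη]
  · simp only [isSimplex_subdivide_insertNone, Finset.eraseNone_insertNone,
      Finset.none_mem_insertNone, true_imp_iff]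
    exact and_congr_right fun _ => ⟨fun h => ⟨h.mono Finset.subset_union_right, h⟩, And.right⟩

end Subdivide

theorem isEdge_iff [DecidableEq V] {η : Finset V} :
    K.IsEdge η ↔ ∃ s t, s ≠ t ∧ η = {s, t} ∧ K.IsSimplex {s, t} := by
  rw [IsEdge, mem_faces_iff, Finset.card_eq_two]
  constructor
  · rintro ⟨⟨-, h⟩, s, t, hst, rfl⟩
    exact ⟨s, t, hst, rfl, h⟩
  · rintro ⟨s, t, hst, rfl, h⟩
    exact ⟨⟨by simp, h⟩, s, t, hst, rfl⟩

theorem isSimplex_polygon {m : ℕ} {σ : Finset (ZMod m)} :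
    (polygon m).IsSimplex σ ↔ ∃ i, σ ⊆ {i, i + 1} := by
  rw [polygon, isSimplex_ofSimplices, or_iff_right_iff_imp]
  rintro rfl
  exact ⟨0, Finset.empty_subset _⟩

theorem isSimplex_zeroSphere {σ : Finset Bool} :
    zeroSphere.IsSimplex σ ↔ ¬ (false ∈ σ ∧ true ∈ σ) := by
  rw [zeroSphere, isSimplex_ofSimplices]
  decide +revert

theorem isSimplex_crossPolytope {n : ℕ} {σ : Finset (Fin n × Bool)} :
    (crossPolytope n).IsSimplex σ ↔ ∀ i, ¬ ((i, false) ∈ σ ∧ (i, true) ∈ σ) := by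
  rw [crossPolytope, isSimplex_ofSimplices]
  simp only [isSimplex_zeroSphere, Finset.mem_filter_univ, or_iff_right_iff_imp]
  rintro rfl
  simp

end Simplices

section Flag

variable {V W : Type*} {K : PreAbstractSimplicialComplex V} {L : PreAbstractSimplicialComplex W}

theorem isFlag_iff [DecidableEq V] :
    K.IsFlag ↔ ∀ T : Finset V, (∀ v ∈ T, ∀ w ∈ T, K.IsSimplex {v, w}) → K.IsSimplex T := by
  refine forall_congr' fun T => ⟨fun h hT => h (fun v hv => ?_) fun v hv w hw hvw => ?_,
    fun h hV hE => h fun v hv w hw => ?_⟩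
  · simpa [singleton_mem_faces_iff] using hT v hv v hv
  · exact isEdge_iff.mpr ⟨v, w, hvw, rfl, hT v hv w hw⟩
  · by_cases hvw : v = w
    · simpa [hvw] using singleton_mem_faces_iff.mp (hV w hw)
    · exact Or.inr (hE v hv w hw hvw).1

theorem isFlag_join [DecidableEq V] [DecidableEq W] (hK : K.IsFlag) (hL : L.IsFlag) :
    (K.join L).IsFlag := by
  rw [isFlag_iff] at *
  intro T hT
  rw [isSimplex_join]
  constructor
  · refine hK _ fun v hv w hw => ?_
    have h := (isSimplex_join.mp (hT _ (Finset.mem_toLeft.mp hv) _ (Finset.mem_toLeft.mp hw))).1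
    exact h.mono (by simp [Finset.insert_subset_iff])
  · refine hL _ fun v hv w hw => ?_
    have h := (isSimplex_join.mp (hT _ (Finset.mem_toRight.mp hv) _ (Finset.mem_toRight.mp hw))).2
    exact h.mono (by simp [Finset.insert_subset_iff])

theorem isFlag_subdivide [DecidableEq V] (hK : K.IsFlag) {η : Finset V} (hη : K.IsEdge η) :
    (K.subdivide η).IsFlag := by
  obtain ⟨s, t, -, rfl, hst⟩ := isEdge_iff.mp hη
  have hne : ({s, t} : Finset V).Nonempty := Finset.insert_nonempty s {t}
  rw [isFlag_iff] at *
  intro T hT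
  have hpair : ∀ v ∈ T.eraseNone, ∀ w ∈ T.eraseNone,
      ¬ {s, t} ⊆ ({v, w} : Finset V) ∧ K.IsSimplex {v, w} := by
    intro v hv w hw
    rw [← isSimplex_subdivide_map_some hne]
    simpa using hT _ (Finset.mem_eraseNone.mp hv) _ (Finset.mem_eraseNone.mp hw)
  have hcone (hn : none ∈ T) : ∀ v ∈ T.eraseNone, K.IsSimplex ({s, t} ∪ {v}) := by
    intro v hv
    have h := hT _ hn _ (Finset.mem_eraseNone.mp hv)
    rw [show {none, some v} = Finset.insertNone {v} by ext (_ | x) <;> simp] at h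
    exact (isSimplex_subdivide_insertNone.mp h).2
  rw [isSimplex_subdivide hne]
  refine ⟨fun h => ?_, hK _ fun v hv w hw => (hpair v hv w hw).2, fun hn => hK _ ?_⟩
  · exact (hpair s (h (by simp)) t (h (by simp))).1 subset_rfl
  · intro v hv w hw
    rcases Finset.mem_union.mp hv with hv | hv <;> rcases Finset.mem_union.mp hw with hw | hw
    · exact hst.mono (by grind)
    · exact (hcone hn w hw).mono (by grind)
    · exact (hcone hn v hv).mono (by grind)
    · exact (hpair v hv w hw).2

theorem isFlag_polygon_five : (polygon 5).IsFlag := by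
  simp only [isFlag_iff, isSimplex_polygon]
  decide

theorem isFlag_zeroSphere : zeroSphere.IsFlag := by
  simp only [isFlag_iff, isSimplex_zeroSphere]
  decide

end Flag

section Isomorphism

variable {U V W V' W' : Type*} {K : PreAbstractSimplicialComplex V}
  {L : PreAbstractSimplicialComplex W} {K' : PreAbstractSimplicialComplex V'}
  {L' : PreAbstractSimplicialComplex W'}

theorem map_mem_faces_iff_iff {φ : U ↪ V} {ψ : U ↪ W} {τ : Finset U} :
    (τ.map φ ∈ K.faces ↔ τ.map ψ ∈ L.faces) ↔
      (K.IsSimplex (τ.map φ) ↔ L.IsSimplex (τ.map ψ)) := by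
  rcases τ.eq_empty_or_nonempty with rfl | hτ
  · simp [mem_faces_iff, isSimplex_empty]
  · simp [mem_faces_iff, hτ]

theorem exists_equiv_vertices (φ : U ↪ V) (hφ : ∀ v, K.IsSimplex {v} → v ∈ Set.range φ) :
    ∃ e : {u // {φ u} ∈ K.faces} ≃ {v // {v} ∈ K.faces}, ∀ u, (e u : V) = φ u := by
  refine ⟨.ofBijective (fun u => ⟨φ u, u.2⟩) ⟨fun u u' h => ?_, fun ⟨v, hv⟩ => ?_⟩, fun _ => rfl⟩
  · exact Subtype.ext (φ.injective (congrArg Subtype.val h))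
  · obtain ⟨u, rfl⟩ := hφ v (singleton_mem_faces_iff.mp hv)
    exact ⟨⟨u, hv⟩, rfl⟩

theorem isIsomorphic_of_labellings (φ : U ↪ V) (ψ : U ↪ W)
    (hφ : ∀ v, K.IsSimplex {v} → v ∈ Set.range φ) (hψ : ∀ w, L.IsSimplex {w} → w ∈ Set.range ψ)
    (h : ∀ τ : Finset U, K.IsSimplex (τ.map φ) ↔ L.IsSimplex (τ.map ψ)) : K.IsIsomorphic L := by
  have hvert (u : U) : {φ u} ∈ K.faces ↔ {ψ u} ∈ L.faces := by
    simpa [singleton_mem_faces_iff] using h {u}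
  obtain ⟨eK, heK⟩ := exists_equiv_vertices φ hφ
  obtain ⟨eL, heL⟩ := exists_equiv_vertices ψ hψ
  refine ⟨eK.symm.trans ((Equiv.subtypeEquivRight hvert).trans eL), fun σ => ?_⟩
  obtain ⟨τ, rfl⟩ : ∃ τ, τ.map eK.toEmbedding = σ :=
    ⟨σ.map eK.symm.toEmbedding, by ext; simp⟩
  convert map_mem_faces_iff_iff.mpr (h (τ.map (.subtype _))) using 2 <;>
  · simp only [Finset.map_map]
    congr 1
    ext u
    simp [heK, heL]

theorem exists_labelling_of_isIsomorphic (h : K.IsIsomorphic L) :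
    ∃ ψ : {v // {v} ∈ K.faces} ↪ W, (∀ w, L.IsSimplex {w} → w ∈ Set.range ψ) ∧
      ∀ τ : Finset {v // {v} ∈ K.faces},
        K.IsSimplex (τ.map (.subtype _)) ↔ L.IsSimplex (τ.map ψ) := by
  obtain ⟨e, he⟩ := h
  refine ⟨e.toEmbedding.trans (.subtype _), fun w hw => ?_, fun τ => ?_⟩
  · exact ⟨e.symm ⟨w, singleton_mem_faces_iff.mpr hw⟩, by simp⟩
  · rw [← map_mem_faces_iff_iff, he, Finset.map_map]

theorem isIsomorphic_trans (h : K.IsIsomorphic L) (h' : L.IsIsomorphic K') :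
    K.IsIsomorphic K' := by
  obtain ⟨e, he⟩ := h
  obtain ⟨e', he'⟩ := h'
  exact ⟨e.trans e', fun σ => by
    rw [he, he', Equiv.trans_toEmbedding, ← Finset.map_map e.toEmbedding]⟩

theorem isIsomorphic_refl : K.IsIsomorphic K := ⟨.refl _, by simp⟩

theorem toLeft_map_sumMap (φ : V ↪ V') (ψ : W ↪ W') (τ : Finset (V ⊕ W)) :
    (τ.map (φ.sumMap ψ)).toLeft = τ.toLeft.map φ := by
  ext; simp

theorem toRight_map_sumMap (φ : V ↪ V') (ψ : W ↪ W') (τ : Finset (V ⊕ W)) :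
    (τ.map (φ.sumMap ψ)).toRight = τ.toRight.map ψ := by
  ext; simp

theorem mem_range_sumMap_of_isSimplex_join {φ : V' ↪ V} {ψ : W' ↪ W}
    (hφ : ∀ v, K.IsSimplex {v} → v ∈ Set.range φ) (hψ : ∀ w, L.IsSimplex {w} → w ∈ Set.range ψ)
    (x : V ⊕ W) (hx : (K.join L).IsSimplex {x}) : x ∈ Set.range (φ.sumMap ψ) := by
  rw [isSimplex_join] at hx
  rcases x with v | w
  · simpa using hφ v (hx.1.mono (by simp))
  · simpa using hψ w (hx.2.mono (by simp))

theorem isIsomorphic_join (hK : K.IsIsomorphic K') (hL : L.IsIsomorphic L') :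
    (K.join L).IsIsomorphic (K'.join L') := by
  obtain ⟨φ, hφ, hφ'⟩ := exists_labelling_of_isIsomorphic hK
  obtain ⟨ψ, hψ, hψ'⟩ := exists_labelling_of_isIsomorphic hL
  refine isIsomorphic_of_labellings (.sumMap (.subtype _) (.subtype _)) (φ.sumMap ψ)
    (mem_range_sumMap_of_isSimplex_join ?_ ?_) (mem_range_sumMap_of_isSimplex_join hφ hψ) ?_
  · simp [singleton_mem_faces_iff]
  · simp [singleton_mem_faces_iff]
  · intro τ
    rw [isSimplex_join, isSimplex_join, toLeft_map_sumMap, toLeft_map_sumMap, toRight_map_sumMap,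
      toRight_map_sumMap, hφ', hψ']

end Isomorphism

section Links

variable {V W : Type*} {K : PreAbstractSimplicialComplex V} {L : PreAbstractSimplicialComplex W}

theorem eq_of_forall_isSimplex_iff {K' : PreAbstractSimplicialComplex V}
    (h : ∀ σ, K.IsSimplex σ ↔ K'.IsSimplex σ) : K = K' := by
  ext σ
  exact mem_faces_iff.trans ((and_congr_right fun _ => h σ).trans mem_faces_iff.symm)

theorem link_join [DecidableEq V] [DecidableEq W] {σ : Finset V} {τ : Finset W}
    (hσ : K.IsSimplex σ) (hτ : L.IsSimplex τ) :
    (K.join L).link (σ.disjSum τ) = (K.link σ).join (L.link τ) := by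
  have hστ : (K.join L).IsSimplex (σ.disjSum τ) := by simpa [isSimplex_join] using ⟨hσ, hτ⟩
  refine eq_of_forall_isSimplex_iff fun ρ => ?_
  have hdisj : Disjoint (σ.disjSum τ) ρ ↔ Disjoint σ ρ.toLeft ∧ Disjoint τ ρ.toRight := by
    simp [Finset.disjoint_left]
  rw [isSimplex_join, isSimplex_link hσ, isSimplex_link hτ, isSimplex_link hστ, isSimplex_join,
    hdisj, Finset.toLeft_union, Finset.toRight_union, Finset.toLeft_disjSum,
    Finset.toRight_disjSum, and_and_and_comm]

theorem disjoint_map_subtype_notMem (η : Finset V) (σ : Finset {v // v ∉ η}) :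
    Disjoint η (σ.map (.subtype _)) := by
  rw [Finset.disjoint_right]
  intro _ hv
  obtain ⟨v, -, rfl⟩ := Finset.mem_map.mp hv
  exact v.2

section Subdivide

variable [DecidableEq V] {s t : V} {η σ : Finset V}

theorem isSimplex_subdivide_singleton_none (hη : η ∈ K.faces) :
    (K.subdivide η).IsSimplex {none} := by
  obtain ⟨hne, hη⟩ := mem_faces_iff.mp hη
  rw [show {none} = Finset.insertNone ∅ by ext (_ | x) <;> simp, isSimplex_subdivide_insertNone]
  simpa [Finset.subset_empty, hne.ne_empty] using hη

theorem isSimplex_link_subdivide_none (hη : η ∈ K.faces) :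
    ((K.subdivide η).link {none}).IsSimplex (σ.map .some) ↔
      ¬ η ⊆ σ ∧ K.IsSimplex (η ∪ σ) := by
  have hcone : {none} ∪ σ.map .some = Finset.insertNone σ := by ext (_ | x) <;> simp
  rw [isSimplex_link (isSimplex_subdivide_singleton_none hη), hcone,
    isSimplex_subdivide_insertNone]
  simp

theorem isSimplex_subdivide_none_some (hst : s ≠ t) (h : {s, t} ∈ K.faces) :
    (K.subdivide {s, t}).IsSimplex {none, some s} := by
  rw [show {none, some s} = Finset.insertNone {s} by ext (_ | x) <;> simp,
    isSimplex_subdivide_insertNone]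
  refine ⟨fun hs => hst ?_, (mem_faces_iff.mp h).2.mono (by grind)⟩
  simpa [eq_comm] using hs (Finset.mem_insert_of_mem (Finset.mem_singleton_self t))

theorem isIsomorphic_link_subdivide_none_some (hst : s ≠ t) (h : {s, t} ∈ K.faces) :
    ((K.subdivide {s, t}).link {none, some s}).IsIsomorphic (K.link {s, t}) := by
  have hsub := isSimplex_subdivide_none_some hst h
  refine isIsomorphic_of_labellings .some (.refl _) ?_ (by simp) fun σ => ?_
  · rintro (_ | v) hv
    · simp [isSimplex_link hsub] at hv
    · exact ⟨v, rfl⟩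
  · have hcone : {none, some s} ∪ σ.map .some = Finset.insertNone (insert s σ) := by
      ext (_ | x) <;> simp
    have hunion : {s, t} ∪ insert s σ = {s, t} ∪ σ := by grind
    rw [isSimplex_link hsub, hcone, Finset.map_refl, isSimplex_link (mem_faces_iff.mp h).2,
      isSimplex_subdivide_insertNone, hunion, ← and_assoc]
    refine and_congr_left' ?_
    simp [Finset.insert_subset_iff, hst.symm]

theorem isIsomorphic_link_subdivide_none (hst : s ≠ t) (h : {s, t} ∈ K.faces) :
    ((K.subdivide {s, t}).link {none}).IsIsomorphic ((K.link {s, t}).join zeroSphere) := by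
  have hη := (mem_faces_iff.mp h).2
  let φ : {v // v ∉ ({s, t} : Finset V)} ⊕ Bool ↪ V :=
    ⟨Sum.elim (↑) fun b => bif b then t else s,
      Subtype.val_injective.sumElim (by rintro (_ | _) (_ | _) <;> simp [hst, hst.symm]) <| by
        rintro ⟨v, hv⟩ (_ | _) (h : v = _) <;> subst h <;> simp at hv⟩
  have hrange (v : V) : v ∈ Set.range φ := by
    by_cases hv : v ∈ ({s, t} : Finset V)
    · obtain rfl | rfl := by simpa using hv
      exacts [⟨.inr false, rfl⟩, ⟨.inr true, rfl⟩]
    · exact ⟨.inl ⟨v, hv⟩, rfl⟩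
  refine isIsomorphic_of_labellings (φ.trans .some) (.sumMap (.subtype _) (.refl _)) ?_
    (mem_range_sumMap_of_isSimplex_join (fun v hv => ?_) (by simp)) fun τ => ?_
  · rintro (_ | v) hv
    · simp [isSimplex_link (isSimplex_subdivide_singleton_none h)] at hv
    · obtain ⟨u, rfl⟩ := hrange v
      exact ⟨u, rfl⟩
  · simpa using (isSimplex_link hη).mp hv |>.1
  · have hends : {s, t} ⊆ τ.map φ ↔ .inr false ∈ τ ∧ .inr true ∈ τ := by
      rw [Finset.insert_subset_iff, Finset.singleton_subset_iff, ← Finset.mem_map' φ,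
        ← Finset.mem_map' φ (a := .inr true)]
      rfl
    have hunion : {s, t} ∪ τ.map φ = {s, t} ∪ τ.toLeft.map (.subtype _) := by
      ext v
      obtain ⟨⟨v, hv⟩ | _ | _, rfl⟩ := hrange v
      · have hmem : v ∈ τ.map φ ↔ .inl ⟨v, hv⟩ ∈ τ :=
          Finset.mem_map' φ (a := .inl ⟨v, hv⟩)
        have hmem' : v ∈ τ.toLeft.map (.subtype _) ↔ .inl ⟨v, hv⟩ ∈ τ :=
          (Finset.mem_map' (.subtype _) (a := ⟨v, hv⟩)).trans Finset.mem_toLeft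
        simp only [φ, Function.Embedding.coeFn_mk, Sum.elim_inl, Finset.mem_union, hmem']
        exact or_congr_right hmem
      · simp [φ]
      · simp [φ]
    rw [← Finset.map_map, isSimplex_link_subdivide_none h, isSimplex_join, hends, hunion,
      toLeft_map_sumMap, toRight_map_sumMap, isSimplex_link hη, isSimplex_zeroSphere]
    simp [disjoint_map_subtype_notMem, and_comm]

end Subdivide

theorem isIsomorphic_crossPolytope_join_zeroSphere (n : ℕ) :
    ((crossPolytope n).join zeroSphere).IsIsomorphic (crossPolytope (n + 1)) := by
  let φ : (Fin n × Bool) ⊕ Bool ↪ Fin (n + 1) × Bool :=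
    ⟨Sum.elim (fun x => (x.1.castSucc, x.2)) fun b => (Fin.last n, b), by
      rintro (⟨i, b⟩ | b) (⟨j, c⟩ | c) h <;>
        simp_all [Fin.ext_iff] <;> omega⟩
  refine isIsomorphic_of_labellings (.refl _) φ (by simp) ?_ fun τ => ?_
  · rintro ⟨i, b⟩ -
    refine i.lastCases ⟨.inr b, rfl⟩ fun j => ⟨.inl (j, b), rfl⟩
  · rw [Finset.map_refl, isSimplex_join, isSimplex_crossPolytope, isSimplex_crossPolytope,
      Fin.forall_fin_succ', isSimplex_zeroSphere]
    have hφ (x) : φ x ∈ τ.map φ ↔ x ∈ τ := Finset.mem_map' φ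
    have hinl (i b) : (Fin.castSucc i, b) ∈ τ.map φ ↔ .inl (i, b) ∈ τ := hφ (.inl (i, b))
    have hinr (b) : (Fin.last n, b) ∈ τ.map φ ↔ .inr b ∈ τ := hφ (.inr b)
    simp only [Finset.mem_toLeft, Finset.mem_toRight, hinl, hinr]

theorem isIsomorphic_link_polygon_five (x : ZMod 5) :
    ((polygon 5).link {x}).IsIsomorphic zeroSphere := by
  have hx : (polygon 5).IsSimplex {x} := isSimplex_polygon.mpr ⟨x, by simp⟩
  let φ : Bool ↪ ZMod 5 := ⟨fun b => x + bif b then 1 else -1, by clear hx; decide +revert⟩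
  refine isIsomorphic_of_labellings φ (.refl _) ?_ (by simp) ?_
  all_goals
    simp only [isSimplex_link hx, isSimplex_polygon, Finset.map_refl, isSimplex_zeroSphere]
    clear hx
    decide +revert

theorem isIsomorphic_zeroSphere_join_zeroSphere :
    (zeroSphere.join zeroSphere).IsIsomorphic (polygon 4) := by
  let φ : Bool ⊕ Bool ↪ ZMod 4 :=
    ⟨Sum.elim (fun b => bif b then 2 else 0) fun b => bif b then 3 else 1, by decide⟩
  refine isIsomorphic_of_labellings (.refl _) φ (by simp) ?_ ?_
  all_goals simp only [isSimplex_join, isSimplex_polygon, Finset.map_refl, isSimplex_zeroSphere]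
  all_goals decide

theorem isIsomorphic_polygon_four :
    (polygon 4).IsIsomorphic (crossPolytope 2) := by
  let φ : ZMod 4 ↪ Fin 2 × Bool :=
    ⟨fun x => ![(0, false), (1, false), (0, true), (1, true)] x, by decide⟩
  refine isIsomorphic_of_labellings (.refl _) φ (by simp) ?_ ?_
  all_goals simp only [isSimplex_polygon, Finset.map_refl, isSimplex_crossPolytope]
  all_goals decide

end Links

section Edges

variable {V W : Type*} {K : PreAbstractSimplicialComplex V}
  {L : PreAbstractSimplicialComplex W}

theorem isEdge_disjSum_singleton {v : V} {w : W} (hv : K.IsSimplex {v}) (hw : L.IsSimplex {w}) :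
    (K.join L).IsEdge (({v} : Finset V).disjSum {w}) := by
  refine ⟨mem_faces_iff.mpr ⟨?_, ?_⟩, by simp⟩
  · exact Finset.card_pos.mp (by simp)
  · simpa [isSimplex_join] using ⟨hv, hw⟩

theorem isSimplex_polygon_singleton {m : ℕ} (x : ZMod m) : (polygon m).IsSimplex {x} :=
  isSimplex_polygon.mpr ⟨x, by simp⟩

theorem exists_isEdge_link_isIsomorphic_polygon_four :
    ∃ η, ((polygon 5).join (polygon 5)).IsEdge η ∧
      (((polygon 5).join (polygon 5)).link η).IsIsomorphic (polygon 4) := by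
  have h := isSimplex_polygon_singleton (0 : ZMod 5)
  refine ⟨_, isEdge_disjSum_singleton h h, ?_⟩
  rw [link_join h h]
  exact isIsomorphic_trans (isIsomorphic_join (isIsomorphic_link_polygon_five 0)
    (isIsomorphic_link_polygon_five 0)) isIsomorphic_zeroSphere_join_zeroSphere

theorem exists_isEdge_link_subdivide_join_isIsomorphic_crossPolytope [DecidableEq V]
    {η : Finset V} {n : ℕ} (hη : K.IsEdge η)
    (hlink : (K.link η).IsIsomorphic (crossPolytope n)) :
    ∃ θ, ((K.subdivide η).join (polygon 5)).IsEdge θ ∧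
      (((K.subdivide η).join (polygon 5)).link θ).IsIsomorphic (crossPolytope (n + 2)) := by
  obtain ⟨s, t, hst, rfl, -⟩ := isEdge_iff.mp hη
  have hnone := isSimplex_subdivide_singleton_none hη.1
  have h0 := isSimplex_polygon_singleton (0 : ZMod 5)
  refine ⟨_, isEdge_disjSum_singleton hnone h0, ?_⟩
  rw [link_join hnone h0]
  have hcross : ((K.subdivide {s, t}).link {none}).IsIsomorphic (crossPolytope (n + 1)) :=
    isIsomorphic_trans (isIsomorphic_link_subdivide_none hst hη.1) <|
      isIsomorphic_trans (isIsomorphic_join hlink isIsomorphic_refl)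
        (isIsomorphic_crossPolytope_join_zeroSphere n)
  exact isIsomorphic_trans (isIsomorphic_join hcross (isIsomorphic_link_polygon_five 0))
    (isIsomorphic_crossPolytope_join_zeroSphere (n + 1))

theorem exists_isEdge_subdivide_link_isIsomorphic [DecidableEq V] {η : Finset V}
    (hη : K.IsEdge η) (hlink : (K.link η).IsIsomorphic L) :
    ∃ κ, (K.subdivide η).IsEdge κ ∧ ((K.subdivide η).link κ).IsIsomorphic L := by
  obtain ⟨s, t, hst, rfl, -⟩ := isEdge_iff.mp hη
  refine ⟨{none, some s}, isEdge_iff.mpr ⟨none, some s, by simp, rfl, ?_⟩, ?_⟩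
  · exact isSimplex_subdivide_none_some hst hη.1
  · exact isIsomorphic_trans (isIsomorphic_link_subdivide_none_some hst hη.1) hlink

end Edges

section FPolynomial

variable {U V W : Type*} [Fintype U] [Fintype V] [Fintype W]

theorem fPoly_eq_sum (K : PreAbstractSimplicialComplex V) [DecidablePred K.IsSimplex] :
    K.fPoly = ∑ σ : Finset V with K.IsSimplex σ, X ^ σ.card := by
  rw [fPoly]
  congr!

theorem coeff_fPoly (K : PreAbstractSimplicialComplex V) [DecidablePred K.IsSimplex] (k : ℕ) :
    K.fPoly.coeff k = (Finset.univ.filter fun σ : Finset V => K.IsSimplex σ ∧ σ.card = k).card := by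
  rw [fPoly_eq_sum, finsetSum_coeff]
  simp only [coeff_X_pow, Finset.sum_boole, Finset.filter_filter, eq_comm]

theorem rank_eq_natDegree_fPoly (K : PreAbstractSimplicialComplex V) :
    K.rank = K.fPoly.natDegree := by
  classical
  apply le_antisymm
  · rw [rank]
    refine Finset.sup_le fun σ hσ => le_natDegree_of_ne_zero ?_
    rw [coeff_fPoly, Nat.cast_ne_zero, Finset.card_ne_zero]
    exact ⟨σ, by simpa using hσ⟩
  · rw [fPoly]
    refine natDegree_sum_le_of_forall_le _ _ fun σ hσ => ?_
    rw [natDegree_X_pow]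
    exact Finset.le_sup (f := Finset.card) hσ

theorem fPoly_join (K : PreAbstractSimplicialComplex V) (L : PreAbstractSimplicialComplex W) :
    (K.join L).fPoly = K.fPoly * L.fPoly := by
  classical
  simp only [fPoly_eq_sum, Finset.sum_mul_sum, ← Finset.sum_product']
  refine Finset.sum_nbij' (fun ρ => (ρ.toLeft, ρ.toRight)) (fun p => p.1.disjSum p.2)
    (by simp [isSimplex_join]) (by simp [isSimplex_join]) (fun ρ _ => ?_) (by simp) fun ρ _ => ?_
  · exact ρ.toLeft_disjSum_toRight
  rw [← pow_add, ρ.card_toLeft_add_card_toRight]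

theorem fPoly_eq_sum_map {K : PreAbstractSimplicialComplex V} [DecidablePred K.IsSimplex]
    (φ : U ↪ V) (hφ : ∀ v, K.IsSimplex {v} → v ∈ Set.range φ) :
    K.fPoly = ∑ τ : Finset U with K.IsSimplex (τ.map φ), X ^ τ.card := by
  classical
  rw [fPoly_eq_sum]
  refine .symm <| Finset.sum_bij (fun τ _ => τ.map φ) (by simp) (by simp) (fun σ hσ => ?_) (by simp)
  have hσ' : K.IsSimplex σ := by simpa using hσ
  have hrange : (σ : Set V) ⊆ Set.range φ := fun v hv =>
    hφ v (hσ'.mono (Finset.singleton_subset_iff.mpr hv))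
  obtain ⟨τ, rfl⟩ : ∃ τ : Finset U, τ.map φ = σ := by
    refine ⟨Finset.univ.filter fun u => φ u ∈ σ, ?_⟩
    ext v
    simp only [Finset.mem_map, Finset.mem_filter_univ]
    exact ⟨fun ⟨_, hu, h⟩ => h ▸ hu, fun hv => let ⟨u, h⟩ := hrange hv; ⟨u, h ▸ hv, h⟩⟩
  exact ⟨τ, by simpa using hσ', rfl⟩

theorem fPoly_eq_of_isIsomorphic {K : PreAbstractSimplicialComplex V}
    {L : PreAbstractSimplicialComplex W} (h : K.IsIsomorphic L) : K.fPoly = L.fPoly := by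
  classical
  obtain ⟨ψ, hψ, hiff⟩ := exists_labelling_of_isIsomorphic h
  rw [fPoly_eq_sum_map ψ hψ, fPoly_eq_sum_map (K := K) (.subtype fun v => {v} ∈ K.faces)
    (by simp [singleton_mem_faces_iff])]
  simp only [hiff]

section Subdivide

theorem sum_finset_option {M : Type*} [AddCommMonoid M] (g : Finset (Option V) → M) :
    ∑ ρ, g ρ = ∑ σ : Finset V, g (σ.map .some) + ∑ σ : Finset V, g (Finset.insertNone σ) := by
  classical
  rw [← Finset.sum_filter_not_add_sum_filter Finset.univ (none ∈ ·)]
  congr 1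
  · refine Finset.sum_nbij' Finset.eraseNone (Finset.map .some) (by simp) (by simp) ?_ (by simp) ?_
    all_goals
      intro ρ hρ
      obtain ⟨σ, rfl | rfl⟩ := exists_eq_map_some_or_eq_insertNone ρ <;> simp_all
  · refine Finset.sum_nbij' Finset.eraseNone Finset.insertNone (by simp) (by simp) ?_ (by simp) ?_
    all_goals
      intro ρ hρ
      obtain ⟨σ, rfl | rfl⟩ := exists_eq_map_some_or_eq_insertNone ρ <;> simp_all

variable [DecidableEq V] {K : PreAbstractSimplicialComplex V} {η : Finset V}

section Sums

variable [DecidablePred K.IsSimplex]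

theorem sum_isSimplex_of_subset (hη : K.IsSimplex η) :
    ∑ σ with K.IsSimplex σ ∧ η ⊆ σ, (X : ℤ[X]) ^ σ.card = X ^ η.card * (K.link η).fPoly := by
  classical
  rw [fPoly_eq_sum, Finset.mul_sum]
  refine Finset.sum_nbij' (· \ η) (η ∪ ·) ?_ ?_ ?_ ?_ ?_
  · simp +contextual [isSimplex_link hη, Finset.disjoint_sdiff, Finset.union_eq_right.mpr]
  · simp +contextual [isSimplex_link hη]
  · simp +contextual
  · simp +contextual [isSimplex_link hη, Finset.union_sdiff_cancel_left]
  · intro σ hσ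
    rw [← pow_add, add_comm, Finset.card_sdiff_add_card_eq_card (by simp_all)]

theorem sum_isSimplex_union (hη : K.IsSimplex η) :
    ∑ σ with K.IsSimplex (η ∪ σ), (X : ℤ[X]) ^ σ.card =
      (1 + X) ^ η.card * (K.link η).fPoly := by
  have hpow : (1 + X : ℤ[X]) ^ η.card = ∑ ζ ∈ η.powerset, X ^ ζ.card := by
    simpa [add_comm] using (Finset.sum_pow_mul_eq_add_pow (X : ℤ[X]) 1 η).symm
  classical
  rw [hpow, fPoly_eq_sum, Finset.sum_mul_sum, ← Finset.sum_product']
  refine Finset.sum_nbij' (fun σ => (σ ∩ η, σ \ η)) (fun x => x.1 ∪ x.2) ?_ ?_ ?_ ?_ ?_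
  · simp [isSimplex_link hη, Finset.disjoint_sdiff]
  · rintro ⟨ζ, τ⟩ h
    simp only [Finset.mem_product, Finset.mem_powerset, Finset.mem_filter_univ,
      isSimplex_link hη] at h ⊢
    rw [← Finset.union_assoc, Finset.union_eq_left.mpr h.1]
    exact h.2.2
  · intro σ _
    rw [Finset.union_comm, Finset.sdiff_union_inter]
  · rintro ⟨ζ, τ⟩ h
    simp only [Finset.mem_product, Finset.mem_powerset, Finset.mem_filter_univ,
      isSimplex_link hη] at h
    have hdisj := h.2.1
    rw [Finset.disjoint_left] at hdisj
    ext x <;> grind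
  · intro σ _
    rw [← pow_add, add_comm, Finset.card_sdiff_add_card_inter]

theorem sum_isSimplex_of_not_subset (hη : K.IsSimplex η) :
    ∑ σ with ¬ η ⊆ σ ∧ K.IsSimplex σ, (X : ℤ[X]) ^ σ.card =
      K.fPoly - X ^ η.card * (K.link η).fPoly := by
  rw [← sum_isSimplex_of_subset hη, eq_sub_iff_add_eq, fPoly_eq_sum,
    ← Finset.sum_filter_not_add_sum_filter (Finset.univ.filter K.IsSimplex) (η ⊆ ·)]
  simp only [Finset.filter_filter, and_comm]

theorem sum_isSimplex_union_of_not_subset (hη : K.IsSimplex η) :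
    ∑ σ with ¬ η ⊆ σ ∧ K.IsSimplex (η ∪ σ), (X : ℤ[X]) ^ σ.card =
      ((1 + X) ^ η.card - X ^ η.card) * (K.link η).fPoly := by
  rw [sub_mul, ← sum_isSimplex_of_subset hη, ← sum_isSimplex_union hη, eq_sub_iff_add_eq,
    ← Finset.sum_filter_not_add_sum_filter
      (Finset.univ.filter fun σ => K.IsSimplex (η ∪ σ)) (η ⊆ ·)]
  simp only [Finset.filter_filter, and_comm]
  congr 2
  ext σ
  simp +contextual [Finset.union_eq_right.mpr]

end Sums

theorem fPoly_subdivide (hη : η ∈ K.faces) :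
    (K.subdivide η).fPoly =
      K.fPoly + (X * ((1 + X) ^ η.card - X ^ η.card) - X ^ η.card) * (K.link η).fPoly := by
  classical
  obtain ⟨hne, hsimplex⟩ := mem_faces_iff.mp hη
  rw [fPoly_eq_sum, Finset.sum_filter, sum_finset_option]
  simp only [isSimplex_subdivide_map_some hne, isSimplex_subdivide_insertNone, Finset.card_map,
    Finset.card_insertNone, ← Finset.sum_filter, pow_succ, ← Finset.sum_mul,
    sum_isSimplex_of_not_subset hsimplex, sum_isSimplex_union_of_not_subset hsimplex]
  ring

theorem fPoly_subdivide_of_isEdge (hη : K.IsEdge η) :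
    (K.subdivide η).fPoly = K.fPoly + X * (1 + X) * (K.link η).fPoly := by
  rw [fPoly_subdivide hη.1, hη.2]
  ring

end Subdivide

theorem fPoly_zeroSphere : zeroSphere.fPoly = 1 + 2 * X := by
  have : DecidablePred zeroSphere.IsSimplex := fun _ => decidable_of_iff _ isSimplex_zeroSphere.symm
  rw [fPoly_eq_sum]
  simp only [isSimplex_zeroSphere]
  rw [show (Finset.univ.filter fun σ : Finset Bool => ¬ (false ∈ σ ∧ true ∈ σ)) =
    {∅, {false}, {true}} by decide, Finset.sum_insert (by simp), Finset.sum_pair (by simp)]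
  simp only [Finset.card_empty, pow_zero, Finset.card_singleton, pow_one]
  ring

theorem fPoly_crossPolytope (n : ℕ) : (crossPolytope n).fPoly = (1 + 2 * X) ^ n := by
  classical
  induction n with
  | zero =>
    simp [fPoly_eq_sum, isSimplex_crossPolytope, Finset.eq_empty_of_isEmpty default]
  | succ n ih =>
    rw [← fPoly_eq_of_isIsomorphic (isIsomorphic_crossPolytope_join_zeroSphere n), fPoly_join, ih,
      fPoly_zeroSphere, pow_succ]

theorem fPoly_polygon_five : (polygon 5).fPoly = 1 + 5 * X + 5 * X ^ 2 := by
  have : DecidablePred (polygon 5).IsSimplex := fun _ => decidable_of_iff _ isSimplex_polygon.symm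
  have hsimplices : (Finset.univ.filter fun σ : Finset (ZMod 5) => ∃ i, σ ⊆ {i, i + 1}) =
      {∅} ∪ (Finset.univ.image ({·}) ∪ Finset.univ.image fun i => {i, i + 1}) := by decide
  have hcard (i : ZMod 5) : ({i, i + 1} : Finset (ZMod 5)).card = 2 := by decide +revert
  rw [fPoly_eq_sum]
  simp only [isSimplex_polygon]
  rw [hsimplices, Finset.sum_union (by decide), Finset.sum_union (by decide),
    Finset.sum_image (by decide), Finset.sum_image (by decide)]
  simp [hcard, add_assoc]

end FPolynomial

section HPolynomial

variable {V W : Type*} [Fintype V] [Fintype W]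

theorem hPoly_eq_sum_coeff (K : PreAbstractSimplicialComplex V) :
    K.hPoly = ∑ k ∈ Finset.range (K.rank + 1),
      C (K.fPoly.coeff k) * (X ^ k * (1 - X) ^ (K.rank - k)) := by
  classical
  rw [hPoly, ← Finset.sum_fiberwise_of_maps_to (g := Finset.card)
    (t := Finset.range (K.rank + 1)) fun σ hσ =>
      Finset.mem_range_succ_iff.mpr (Finset.le_sup (f := Finset.card) hσ)]
  refine Finset.sum_congr rfl fun k _ => ?_
  rw [coeff_fPoly, Finset.filter_filter, Finset.sum_congr rfl (g := fun _ =>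
    X ^ k * (1 - X) ^ (K.rank - k)) fun σ hσ => by rw [(Finset.mem_filter.mp hσ).2.2]]
  simp

theorem one_add_pow_rank_mul_aeval_hPoly {F : Type*} [Field F] (K : PreAbstractSimplicialComplex V)
    {w : F} (hw : 1 + w ≠ 0) :
    (1 + w) ^ K.rank * aeval (w / (1 + w)) K.hPoly = aeval w K.fPoly := by
  classical
  simp only [hPoly, fPoly, map_sum, Finset.mul_sum]
  refine Finset.sum_congr rfl fun σ hσ => ?_
  obtain ⟨k, hk⟩ := Nat.exists_eq_add_of_le (show σ.card ≤ K.rank from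
    Finset.le_sup (f := Finset.card) hσ)
  have hsub : 1 - w / (1 + w) = 1 / (1 + w) := by field_simp; ring
  simp only [map_mul, map_pow, map_sub, map_one, aeval_X, hsub, hk, Nat.add_sub_cancel_left,
    div_pow, one_pow, pow_add]
  field_simp

theorem im_div_one_add (w : ℂ) : (w / (1 + w)).im = w.im / Complex.normSq (1 + w) := by
  simp [Complex.div_im]
  ring

theorem hasNonrealHRoot_iff {K : PreAbstractSimplicialComplex V} :
    K.HasNonrealHRoot ↔ ∃ w : ℂ, aeval w K.fPoly = 0 ∧ w.im ≠ 0 := by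
  constructor
  · rintro ⟨z, hz, him⟩
    have hz1 : 1 - z ≠ 0 := fun h => him <| by simpa using congrArg Complex.im h
    obtain ⟨w, hw1, rfl⟩ : ∃ w, 1 + w ≠ 0 ∧ w / (1 + w) = z := by
      have h : 1 + z / (1 - z) = 1 / (1 - z) := by field_simp; ring
      exact ⟨z / (1 - z), by simp [h, hz1], by rw [h]; field_simp⟩
    refine ⟨w, ?_, fun hw => him ?_⟩
    · rw [← one_add_pow_rank_mul_aeval_hPoly K hw1, hz, mul_zero]
    · rw [im_div_one_add, hw, zero_div]
  · rintro ⟨w, hw, him⟩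
    have hw1 : 1 + w ≠ 0 := fun h => him <| by simpa using congrArg Complex.im h
    refine ⟨w / (1 + w), ?_, ?_⟩
    · rw [← one_add_pow_rank_mul_aeval_hPoly K hw1] at hw
      exact (mul_eq_zero.mp hw).resolve_left (pow_ne_zero _ hw1)
    · rw [im_div_one_add]
      exact div_ne_zero him (Complex.normSq_eq_zero.not.mpr hw1)

theorem hasNonrealHRoot_join {K : PreAbstractSimplicialComplex V}
    (hK : K.HasNonrealHRoot) (L : PreAbstractSimplicialComplex W) :
    (K.join L).HasNonrealHRoot := by
  obtain ⟨w, hw, him⟩ := hasNonrealHRoot_iff.mp hK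
  exact hasNonrealHRoot_iff.mpr ⟨w, by rw [fPoly_join, map_mul, hw, zero_mul], him⟩

end HPolynomial

section NonrealRoots

theorem exists_nonreal_root_of_discr_neg {P : Cubic ℝ} (ha : P.a ≠ 0) (hd : P.discr < 0) :
    ∃ u : ℂ, aeval u P.toPoly = 0 ∧ u.im ≠ 0 := by
  by_contra! hreal
  obtain ⟨x, y, z, hroots⟩ := (Cubic.splits_iff_roots_eq_three (φ := algebraMap ℝ ℂ) ha).mp
    (IsAlgClosed.splits _)
  have mem_range {u : ℂ} (hu : u ∈ ({x, y, z} : Multiset ℂ)) : ∃ r : ℝ, (r : ℂ) = u := by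
    rw [← hroots, Cubic.roots, Cubic.map_toPoly] at hu
    have hroot : aeval u P.toPoly = 0 := by
      simpa [aeval_def, eval_map] using (mem_roots'.mp hu).2
    exact ⟨u.re, Complex.ext rfl (hreal u hroot).symm⟩
  obtain ⟨x, rfl⟩ := mem_range (u := x) (by simp)
  obtain ⟨y, rfl⟩ := mem_range (u := y) (by simp)
  obtain ⟨z, rfl⟩ := mem_range (u := z) (by simp)
  have hdiscr := Cubic.discr_eq_prod_three_roots (φ := algebraMap ℝ ℂ) ha hroots
  have hsq : P.discr = (P.a * P.a * (x - y) * (x - z) * (y - z)) ^ 2 := by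
    simpa [← Complex.ofReal_inj] using hdiscr
  exact (hsq ▸ hd).not_ge (sq_nonneg _)

theorem exists_nonreal_root_comp {p q : ℤ[X]} (hq : 0 < q.natDegree)
    (hp : ∃ u : ℂ, aeval u p = 0 ∧ u.im ≠ 0) : ∃ w : ℂ, aeval w (p.comp q) = 0 ∧ w.im ≠ 0 := by
  obtain ⟨u, hu, him⟩ := hp
  obtain ⟨w, rfl⟩ : ∃ w : ℂ, aeval w q = u := by
    have hdeg : (q.map (algebraMap ℤ ℂ)).natDegree ≠ 0 := by
      rw [natDegree_map_eq_of_injective (algebraMap ℤ ℂ).injective_int]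
      exact hq.ne'
    obtain ⟨w, hw⟩ := IsAlgClosed.eval_surjective hdeg u
    exact ⟨w, by rwa [← eval_map_algebraMap]⟩
  refine ⟨w, by rwa [aeval_comp], fun hw => him ?_⟩
  obtain ⟨r, rfl⟩ : ∃ r : ℝ, (r : ℂ) = w := ⟨w.re, Complex.ext rfl (by simp [hw])⟩
  rw [← Complex.coe_algebraMap, aeval_algebraMap_apply]
  exact Complex.ofReal_im _

theorem hasNonrealHRoot_of_fPoly_eq_comp {V : Type*} [Fintype V]
    {K : PreAbstractSimplicialComplex V} {P : Cubic ℤ} {q : ℤ[X]} (ha : P.a ≠ 0)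
    (hd : P.discr < 0) (hq : 0 < q.natDegree) (hK : K.fPoly = P.toPoly.comp q) :
    K.HasNonrealHRoot := by
  rw [hasNonrealHRoot_iff, hK]
  refine exists_nonreal_root_comp hq ?_
  have hdiscr : (P.map (algebraMap ℤ ℝ)).discr = P.discr := by simp [Cubic.discr, Cubic.map]
  obtain ⟨u, hu, him⟩ := exists_nonreal_root_of_discr_neg (P := P.map (algebraMap ℤ ℝ))
    (Int.cast_ne_zero.mpr ha) (hdiscr ▸ Int.cast_lt_zero.mpr hd)
  exact ⟨u, by rwa [Cubic.map_toPoly, aeval_map_algebraMap] at hu, him⟩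

end NonrealRoots

section Polytopal

variable {V W E F : Type*} [NormedAddCommGroup E] [NormedSpace ℝ E] [NormedAddCommGroup F]
  [NormedSpace ℝ F]

/-- The hyperplane `l = 1` supports the convex hull of the points `p v`, and it contains those with
`v ∈ σ` and no others. -/
def SupportsAt (p : V → E) (l : E →L[ℝ] ℝ) (σ : Finset V) : Prop :=
  ∀ v, l (p v) ≤ 1 ∧ (l (p v) = 1 ↔ v ∈ σ)

/-- `K` is the boundary complex of the convex hull of the points `p v`, a simplicial polytope with
the origin in its interior and with vertices `p v`. The origin being inside, every proper face is
cut out by a hyperplane `l = 1`, so that the polytope can be described without convex hulls: the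
first field says that the origin is an interior point, the last one that the vertices of a face are
linearly independent. -/
structure IsPolytopal (K : PreAbstractSimplicialComplex V) (p : V → E) : Prop where
  eq_zero_of_nonpos : ∀ l : E →L[ℝ] ℝ, (∀ v, l (p v) ≤ 0) → l = 0
  isSimplex_singleton : ∀ v, K.IsSimplex {v}
  isSimplex_iff : ∀ σ, K.IsSimplex σ ↔ ∃ l : E →L[ℝ] ℝ, SupportsAt p l σ
  exists_eqOn : ∀ σ, K.IsSimplex σ → ∀ g : V → ℝ, ∃ l : E →L[ℝ] ℝ, ∀ v ∈ σ, l (p v) = g v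

theorem IsPolytopal.map {K : PreAbstractSimplicialComplex V} {p : V → E} (h : IsPolytopal K p)
    (e : E ≃L[ℝ] F) : IsPolytopal K fun v => e (p v) where
  eq_zero_of_nonpos l hl := by
    have hcomp := h.eq_zero_of_nonpos (l.comp (e : E →L[ℝ] F)) hl
    ext y
    simpa using congrArg (fun m => m (e.symm y)) hcomp
  isSimplex_singleton := h.isSimplex_singleton
  isSimplex_iff σ := by
    rw [h.isSimplex_iff]
    exact ⟨fun ⟨l, hl⟩ => ⟨l.comp (e.symm : F →L[ℝ] E), by simpa [SupportsAt] using hl⟩,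
      fun ⟨l, hl⟩ => ⟨l.comp (e : E →L[ℝ] F), hl⟩⟩
  exists_eqOn σ hσ g := by
    obtain ⟨l, hl⟩ := h.exists_eqOn σ hσ g
    exact ⟨l.comp (e.symm : F →L[ℝ] E), by simpa using hl⟩

theorem IsPolytopal.join {K : PreAbstractSimplicialComplex V} {L : PreAbstractSimplicialComplex W}
    {p : V → E} {q : W → F} (hK : IsPolytopal K p) (hL : IsPolytopal L q) :
    IsPolytopal (K.join L) (Sum.elim (fun v => ((p v, 0) : E × F)) fun w => (0, q w)) where
  eq_zero_of_nonpos l hl := by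
    have hinl := hK.eq_zero_of_nonpos (l.comp (.inl ℝ E F)) fun v => hl (.inl v)
    have hinr := hL.eq_zero_of_nonpos (l.comp (.inr ℝ E F)) fun w => hl (.inr w)
    ext x
    · exact congrArg (fun l => l x) hinl
    · exact congrArg (fun l => l x) hinr
  isSimplex_singleton := by
    rintro (v | w)
    · exact isSimplex_join.mpr ⟨(hK.isSimplex_singleton v).mono fun x hx => by simpa using hx,
        (isSimplex_empty L).mono fun x hx => by simp at hx⟩
    · exact isSimplex_join.mpr ⟨(isSimplex_empty K).mono fun x hx => by simp at hx,
        (hL.isSimplex_singleton w).mono fun x hx => by simpa using hx⟩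
  isSimplex_iff σ := by
    rw [isSimplex_join, hK.isSimplex_iff, hL.isSimplex_iff]
    constructor
    · rintro ⟨⟨l, hl⟩, m, hm⟩
      refine ⟨l.coprod m, ?_⟩
      rintro (v | w)
      · simpa using hl v
      · simpa using hm w
    · rintro ⟨l, hl⟩
      exact ⟨⟨l.comp (.inl ℝ E F), fun v => by simpa using hl (.inl v)⟩,
        l.comp (.inr ℝ E F), fun w => by simpa using hl (.inr w)⟩
  exists_eqOn σ hσ g := by
    rw [isSimplex_join] at hσ
    obtain ⟨l, hl⟩ := hK.exists_eqOn _ hσ.1 fun v => g (.inl v)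
    obtain ⟨m, hm⟩ := hL.exists_eqOn _ hσ.2 fun v => g (.inr v)
    refine ⟨l.coprod m, ?_⟩
    rintro (v | w) h
    · simpa using hl v (by simpa using h)
    · simpa using hm w (by simpa using h)

theorem isPolytopal_zeroSphere :
    IsPolytopal zeroSphere fun b : Bool => if b then (1 : ℝ) else -1 where
  eq_zero_of_nonpos l hl := by
    have htrue : l 1 ≤ 0 := hl true
    have hfalse : -l 1 ≤ 0 := by simpa using hl false
    ext
    exact htrue.antisymm (neg_nonpos.mp hfalse)
  isSimplex_singleton v := by cases v <;> simp [isSimplex_zeroSphere]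
  isSimplex_iff σ := by
    rw [isSimplex_zeroSphere]
    constructor
    · intro h
      refine ⟨(if true ∈ σ then 1 else if false ∈ σ then -1 else 0 : ℝ) • .id ℝ ℝ, ?_⟩
      by_cases htrue : true ∈ σ <;> by_cases hfalse : false ∈ σ
      · exact absurd ⟨hfalse, htrue⟩ h
      all_goals simp [SupportsAt, htrue, hfalse] <;> norm_num
    · rintro ⟨l, hl⟩ ⟨hfalse, htrue⟩
      have h1 : l 1 = 1 := (hl true).2.mpr htrue
      have h2 : -l 1 = 1 := by simpa using (hl false).2.mpr hfalse
      linarith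
  exists_eqOn σ hσ g := by
    rw [isSimplex_zeroSphere] at hσ
    by_cases htrue : true ∈ σ
    · exact ⟨g true • .id ℝ ℝ, by rintro (_ | _) h <;> simp_all⟩
    · exact ⟨(-g false) • .id ℝ ℝ, by rintro (_ | _) h <;> simp_all⟩

end Polytopal

section Pentagon

/-- The abscissas of the vertices of a lattice pentagon, in cyclic order. -/
def pentagonX : ZMod 5 → ℤ := (![1, 1, 0, -1, 0] : Fin 5 → ℤ)

/-- The ordinates of the vertices of a lattice pentagon, in cyclic order. -/
def pentagonY : ZMod 5 → ℤ := (![0, 1, 1, 0, -1] : Fin 5 → ℤ)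

/-- The vertices of a lattice pentagon, in cyclic order. -/
def pentagonVertex (v : ZMod 5) : ℝ × ℝ := (pentagonX v, pentagonY v)

theorem pentagonX_mul_pentagonY_sub (i : ZMod 5) :
    pentagonX i * pentagonY (i + 1) - pentagonX (i + 1) * pentagonY i = 1 := by
  decide +revert

theorem pentagonVertex_add (i : ZMod 5) :
    pentagonVertex i + pentagonVertex (i + 2) = pentagonVertex (i + 1) ∨
      pentagonVertex i + pentagonVertex (i + 2) = 0 := by
  have h : (pentagonX i + pentagonX (i + 2) = pentagonX (i + 1) ∧
      pentagonY i + pentagonY (i + 2) = pentagonY (i + 1)) ∨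
      (pentagonX i + pentagonX (i + 2) = 0 ∧ pentagonY i + pentagonY (i + 2) = 0) := by
    decide +revert
  simpa only [pentagonVertex, Prod.mk_add_mk, Prod.mk_eq_zero, Prod.mk.injEq, ← Int.cast_add,
    Int.cast_inj, Int.cast_eq_zero] using h

theorem exists_supportsAt_pentagonVertex {σ : Finset (ZMod 5)} (hσ : ∃ i, σ ⊆ {i, i + 1}) :
    ∃ l : ℝ × ℝ →L[ℝ] ℝ, SupportsAt pentagonVertex l σ := by
  have hint : ∀ σ : Finset (ZMod 5), (∃ i, σ ⊆ {i, i + 1}) →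
      ∃ a ∈ ({-2, -1, 0, 1, 2} : Finset ℤ), ∃ b ∈ ({-2, -1, 0, 1, 2} : Finset ℤ), ∀ v,
        a * pentagonX v + b * pentagonY v ≤ 2 ∧
          (a * pentagonX v + b * pentagonY v = 2 ↔ v ∈ σ) := by decide
  obtain ⟨a, -, b, -, hab⟩ := hint σ hσ
  refine ⟨(2⁻¹ : ℝ) • ((a : ℝ) • .fst ℝ ℝ ℝ + (b : ℝ) • .snd ℝ ℝ ℝ), fun v => ?_⟩
  have hl : ((2⁻¹ : ℝ) • ((a : ℝ) • ContinuousLinearMap.fst ℝ ℝ ℝ +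
      (b : ℝ) • ContinuousLinearMap.snd ℝ ℝ ℝ)) (pentagonVertex v) =
      ((a * pentagonX v + b * pentagonY v : ℤ) : ℝ) / 2 := by
    simp [pentagonVertex]
    ring
  rw [hl, div_le_one two_pos, div_eq_one_iff_eq two_ne_zero, ← (hab v).2]
  exact ⟨by exact_mod_cast (hab v).1, by norm_cast⟩

theorem SupportsAt.exists_subset_of_pentagonVertex {l : ℝ × ℝ →L[ℝ] ℝ} {σ : Finset (ZMod 5)}
    (hl : SupportsAt pentagonVertex l σ) : ∃ i, σ ⊆ {i, i + 1} := by
  have hdiag : ∀ σ : Finset (ZMod 5), (¬ ∃ i, σ ⊆ {i, i + 1}) → ∃ i, i ∈ σ ∧ i + 2 ∈ σ := by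
    decide
  by_contra hσ
  obtain ⟨i, h1, h2⟩ := hdiag σ hσ
  have htwo : l (pentagonVertex i + pentagonVertex (i + 2)) = 2 := by
    rw [map_add, (hl i).2.mpr h1, (hl (i + 2)).2.mpr h2, one_add_one_eq_two]
  rcases pentagonVertex_add i with h | h
  · linarith [(hl (i + 1)).1, h ▸ htwo]
  · norm_num [h] at htwo

theorem exists_eqOn_pentagonVertex (i : ZMod 5) (g : ZMod 5 → ℝ) :
    ∃ l : ℝ × ℝ →L[ℝ] ℝ, ∀ v ∈ ({i, i + 1} : Finset (ZMod 5)), l (pentagonVertex v) = g v := by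
  have hdet : (pentagonX i : ℝ) * pentagonY (i + 1) - pentagonX (i + 1) * pentagonY i = 1 := by
    exact_mod_cast pentagonX_mul_pentagonY_sub i
  refine ⟨(g i * pentagonY (i + 1) - g (i + 1) * pentagonY i) • .fst ℝ ℝ ℝ +
    (g (i + 1) * pentagonX i - g i * pentagonX (i + 1)) • .snd ℝ ℝ ℝ, ?_⟩
  simp only [Finset.forall_mem_insert, Finset.mem_singleton, forall_eq, pentagonVertex,
    add_apply, smul_apply, smul_eq_mul, ContinuousLinearMap.coe_fst', ContinuousLinearMap.coe_snd']
  exact ⟨by linear_combination g i * hdet, by linear_combination g (i + 1) * hdet⟩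

theorem isPolytopal_pentagonVertex : IsPolytopal (polygon 5) pentagonVertex where
  eq_zero_of_nonpos l hl := by
    have hzero {x : ℝ × ℝ} (h : l x ≤ 0) (h' : l (-x) ≤ 0) : l x = 0 := by
      rw [map_neg] at h'
      linarith
    have hx : l (1, 0) = 0 := hzero
      (by simpa [pentagonVertex, pentagonX, pentagonY] using hl 0)
      (by simpa [pentagonVertex, pentagonX, pentagonY] using hl 3)
    have hy : l (0, 1) = 0 := hzero
      (by simpa [pentagonVertex, pentagonX, pentagonY] using hl 2)
      (by simpa [pentagonVertex, pentagonX, pentagonY] using hl 4)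
    ext
    · simpa using hx
    · simpa using hy
  isSimplex_singleton := isSimplex_polygon_singleton
  isSimplex_iff σ := by
    rw [isSimplex_polygon]
    exact ⟨exists_supportsAt_pentagonVertex, fun ⟨_, hl⟩ => hl.exists_subset_of_pentagonVertex⟩
  exists_eqOn σ hσ g := by
    obtain ⟨i, hi⟩ := isSimplex_polygon.mp hσ
    obtain ⟨l, hl⟩ := exists_eqOn_pentagonVertex i g
    exact ⟨l, fun v hv => hl v (hi hv)⟩

end Pentagon

section Subdivision

open Filter Topology

variable {V E : Type*} [NormedAddCommGroup E] [NormedSpace ℝ E]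
  {K : PreAbstractSimplicialComplex V} {p : V → E}

theorem IsPolytopal.isSimplex_of_forall_eq_one [Finite V] (hK : IsPolytopal K p) {l : E →L[ℝ] ℝ}
    (hl : ∀ v, l (p v) ≤ 1) {σ : Finset V} (hσ : ∀ v ∈ σ, l (p v) = 1) : K.IsSimplex σ := by
  have := Fintype.ofFinite V
  exact ((hK.isSimplex_iff (Finset.univ.filter fun v => l (p v) = 1)).mpr
    ⟨l, fun v => ⟨hl v, by simp⟩⟩).mono fun v hv => by simpa using hσ v hv

theorem SupportsAt.eventually_sub_smul [Finite V] {l m : E →L[ℝ] ℝ} {σ τ : Finset V}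
    (hl : SupportsAt p l τ) (hστ : σ ⊆ τ) (hm : ∀ v ∈ σ, m (p v) = 0)
    (hpos : ∀ v ∈ τ, v ∉ σ → 0 < m (p v)) :
    ∀ᶠ δ : ℝ in 𝓝[>] 0, SupportsAt p (l - δ • m) σ := by
  refine eventually_all.mpr fun v => ?_
  simp only [sub_apply, smul_apply, smul_eq_mul]
  by_cases hσ : v ∈ σ
  · simp [hm v hσ, hσ, (hl v).2.mpr (hστ hσ)]
  suffices ∀ᶠ δ : ℝ in 𝓝[>] 0, l (p v) - δ * m (p v) < 1 from
    this.mono fun δ hδ => ⟨hδ.le, iff_of_false hδ.ne hσ⟩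
  by_cases hτ : v ∈ τ
  · filter_upwards [self_mem_nhdsWithin] with δ hδ
    rw [(hl v).2.mpr hτ]
    exact sub_lt_self 1 (mul_pos hδ (hpos v hτ hσ))
  · have hlt : l (p v) < 1 := (hl v).1.lt_of_ne (mt (hl v).2.mp hτ)
    have hcont : Continuous fun δ : ℝ => l (p v) - δ * m (p v) := by fun_prop
    exact (hcont.tendsto' 0 (l (p v)) (by simp)).mono_left nhdsWithin_le_nhds
      |>.eventually_lt_const hlt

/-- The barycentre of the points `p v` with `v ∈ η`; it is the origin if `η` is empty. -/
noncomputable def barycenter (p : V → E) (η : Finset V) : E := (η.card : ℝ)⁻¹ • ∑ v ∈ η, p v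

theorem apply_barycenter_eq_one {η : Finset V} (hη : η.Nonempty) {l : E →L[ℝ] ℝ}
    (hl : ∀ v ∈ η, l (p v) = 1) : l (barycenter p η) = 1 := by
  have hcard : (η.card : ℝ) ≠ 0 := by exact_mod_cast hη.card_ne_zero
  simp [barycenter, Finset.sum_congr rfl hl, hcard]

theorem apply_barycenter_lt_one {η : Finset V} {l : E →L[ℝ] ℝ} (hl : ∀ v ∈ η, l (p v) ≤ 1)
    {v : V} (hv : v ∈ η) (hlt : l (p v) < 1) : l (barycenter p η) < 1 := by
  have hcard : (0 : ℝ) < η.card := by exact_mod_cast Finset.card_pos.mpr ⟨v, hv⟩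
  have hsum : ∑ v ∈ η, l (p v) < ∑ v ∈ η, 1 := Finset.sum_lt_sum hl ⟨v, hv, hlt⟩
  simpa [barycenter, inv_mul_lt_iff₀ hcard] using hsum

theorem IsPolytopal.exists_apply_barycenter_eq_one [DecidableEq V] (hK : IsPolytopal K p)
    {σ η : Finset V} (hση : K.IsSimplex (η ∪ σ)) (hη : ¬ η ⊆ σ) :
    ∃ m : E →L[ℝ] ℝ, m (barycenter p η) = 1 ∧ (∀ v ∈ σ, m (p v) = 0) ∧
      ∀ v ∈ η ∪ σ, v ∉ σ → 0 < m (p v) := by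
  have hdiff : (0 : ℝ) < (η \ σ).card := by
    exact_mod_cast Finset.card_pos.mpr (Finset.sdiff_nonempty.mpr hη)
  have hcard : (0 : ℝ) < η.card := hdiff.trans_le (by
    exact_mod_cast Finset.card_le_card (Finset.sdiff_subset (s := η) (t := σ)))
  obtain ⟨m, hm⟩ := hK.exists_eqOn _ hση fun v => if v ∈ σ then 0 else η.card / (η \ σ).card
  refine ⟨m, ?_, fun v hv => ?_, fun v hv hvσ => ?_⟩
  · have hsum : ∑ v ∈ η, m (p v) = (η \ σ).card * (η.card / (η \ σ).card : ℝ) :=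
      (Finset.sum_congr rfl fun v hv => hm v (Finset.mem_union_left _ hv)).trans (by
        simp [Finset.sum_ite, Finset.sdiff_eq_filter])
    simp only [barycenter, map_smul, map_sum, hsum, smul_eq_mul]
    field_simp
  · rw [hm v (Finset.mem_union_right _ hv), if_pos hv]
  · rw [hm v hv, if_neg hvσ]
    positivity

theorem IsPolytopal.exists_pos_mul_norm_le [Finite V] [Nonempty V] [FiniteDimensional ℝ E]
    (hK : IsPolytopal K p) : ∃ r > 0, ∀ l : E →L[ℝ] ℝ, ∃ v, r * ‖l‖ ≤ l (p v) := by
  have := Fintype.ofFinite V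
  let g (l : E →L[ℝ] ℝ) : ℝ := Finset.univ.sup' Finset.univ_nonempty fun v => l (p v)
  have hg : Continuous g := Continuous.finset_sup'_apply _ fun v _ => by fun_prop
  have hpos : ∀ l ∈ Metric.sphere (0 : E →L[ℝ] ℝ) 1, 0 < g l := fun l hl => by
    by_contra! hle
    have hzero := hK.eq_zero_of_nonpos l fun v =>
      (Finset.le_sup' (fun v => l (p v)) (Finset.mem_univ v)).trans hle
    simp [hzero] at hl
  obtain ⟨r, hr, hle⟩ := (isCompact_sphere _ _).exists_forall_le' hg.continuousOn hpos
  refine ⟨r, hr, fun l => ?_⟩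
  rcases eq_or_ne l 0 with rfl | hl
  · exact ⟨Classical.arbitrary V, by simp⟩
  obtain ⟨v, -, hv⟩ := (Finset.le_sup'_iff _).mp (hle (‖l‖⁻¹ • l) (by simp [norm_smul, hl]))
  refine ⟨v, ?_⟩
  rwa [smul_apply, smul_eq_mul, inv_mul_eq_div, le_div_iff₀ (norm_pos_iff.mpr hl)] at hv

theorem IsPolytopal.isCompact_polar [Finite V] [Nonempty V] [FiniteDimensional ℝ E]
    (hK : IsPolytopal K p) : IsCompact {l : E →L[ℝ] ℝ | ∀ v, l (p v) ≤ 1} := by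
  obtain ⟨r, hr, hbound⟩ := hK.exists_pos_mul_norm_le
  refine Metric.isCompact_of_isClosed_isBounded ?_ ?_
  · simp only [Set.ofPred_forall]
    exact isClosed_iInter fun v => isClosed_le (by fun_prop) continuous_const
  · refine (Metric.isBounded_closedBall (x := 0) (r := r⁻¹)).subset fun l hl => ?_
    obtain ⟨v, hv⟩ := hbound l
    rw [mem_closedBall_zero_iff, ← mul_le_mul_iff_right₀ hr, mul_inv_cancel₀ hr.ne']
    exact hv.trans (hl v)

theorem eventually_mul_lt_one {a : ℝ} (ha : a < 1) : ∀ᶠ c : ℝ in 𝓝[>] 1, c * a < 1 :=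
  ((continuous_mul_const a).tendsto' 1 a (one_mul a)).mono_left nhdsWithin_le_nhds
    |>.eventually_lt_const ha

theorem tendsto_one_sub_inv_nhdsGT_one :
    Tendsto (fun c : ℝ => 1 - c⁻¹) (𝓝[>] 1) (𝓝[>] 0) := by
  refine tendsto_nhdsWithin_of_tendsto_nhds_of_eventually_within _ ?_ ?_
  · have hcont : ContinuousAt (fun c : ℝ => 1 - c⁻¹) 1 := by fun_prop (disch := norm_num)
    simpa using hcont.tendsto.mono_left nhdsWithin_le_nhds
  · filter_upwards [self_mem_nhdsWithin] with c hc
    exact sub_pos.mpr (inv_lt_one_of_one_lt₀ (Set.mem_Ioi.mp hc))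

/-- The vertices of the polytope obtained by adding to the points `p v` a point beyond the
barycentre of `η`, namely the barycentre stretched by a factor `c > 1`. -/
noncomputable def stellarVertex (p : V → E) (η : Finset V) (c : ℝ) (o : Option V) : E :=
  o.elim (c • barycenter p η) p

theorem supportsAt_stellarVertex_map_some {l : E →L[ℝ] ℝ} {σ η : Finset V} {c : ℝ} :
    SupportsAt (stellarVertex p η c) l (σ.map .some) ↔
      c * l (barycenter p η) < 1 ∧ SupportsAt p l σ := by
  simp [SupportsAt, stellarVertex, Option.forall, lt_iff_le_and_ne]

theorem supportsAt_stellarVertex_insertNone {l : E →L[ℝ] ℝ} {σ η : Finset V} {c : ℝ} :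
    SupportsAt (stellarVertex p η c) l (Finset.insertNone σ) ↔
      c * l (barycenter p η) = 1 ∧ SupportsAt p l σ := by
  simp +contextual [SupportsAt, stellarVertex, Option.forall]

variable [DecidableEq V] {σ η : Finset V}

theorem IsPolytopal.eventually_isSimplex_subdivide_map_some_iff (hK : IsPolytopal K p)
    (hη : η.Nonempty) (σ : Finset V) : ∀ᶠ c : ℝ in 𝓝[>] 1,
      ((K.subdivide η).IsSimplex (σ.map .some) ↔
        ∃ l : E →L[ℝ] ℝ, SupportsAt (stellarVertex p η c) l (σ.map .some)) := by
  simp only [supportsAt_stellarVertex_map_some, isSimplex_subdivide_map_some hη]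
  by_cases hσ : ¬ η ⊆ σ ∧ K.IsSimplex σ
  · obtain ⟨l, hl⟩ := (hK.isSimplex_iff σ).mp hσ.2
    obtain ⟨v, hv, hvσ⟩ := Finset.not_subset.mp hσ.1
    have hlt : l (barycenter p η) < 1 := apply_barycenter_lt_one (fun v _ => (hl v).1) hv
      ((hl v).1.lt_of_ne (mt (hl v).2.mp hvσ))
    filter_upwards [eventually_mul_lt_one hlt] with c hc using iff_of_true hσ ⟨l, hc, hl⟩
  · filter_upwards [self_mem_nhdsWithin] with c hc
    refine iff_of_false hσ fun ⟨l, hlt, hl⟩ => hσ ⟨fun hησ => ?_, (hK.isSimplex_iff σ).mpr ⟨l, hl⟩⟩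
    rw [apply_barycenter_eq_one hη fun v hv => (hl v).2.mpr (hησ hv), mul_one] at hlt
    exact lt_asymm hlt hc

theorem IsPolytopal.exists_lt_one_forall_apply_barycenter_le [Finite V] [FiniteDimensional ℝ E]
    (hK : IsPolytopal K p) (hη : η.Nonempty) (hση : ¬ K.IsSimplex (η ∪ σ)) :
    ∃ r < 1, ∀ l : E →L[ℝ] ℝ, SupportsAt p l σ → l (barycenter p η) ≤ r := by
  have : Nonempty V := hη.to_type
  have hclosed : IsClosed {l : E →L[ℝ] ℝ | ∀ v ∈ σ, l (p v) = 1} := by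
    simp only [Set.ofPred_forall]
    exact isClosed_biInter fun v _ => isClosed_eq (by fun_prop) continuous_const
  have hlt : ∀ l ∈ {l : E →L[ℝ] ℝ | ∀ v, l (p v) ≤ 1} ∩ {l | ∀ v ∈ σ, l (p v) = 1},
      l (barycenter p η) < 1 := by
    rintro l ⟨hle, hσ⟩
    obtain ⟨v, hv, hne⟩ : ∃ v ∈ η, l (p v) ≠ 1 := by
      by_contra! hη1
      exact hση (hK.isSimplex_of_forall_eq_one hle fun v hv =>
        (Finset.mem_union.mp hv).elim (hη1 v) (hσ v))
    exact apply_barycenter_lt_one (fun v _ => hle v) hv ((hle v).lt_of_ne hne)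
  obtain ⟨r, hr, hle⟩ := (hK.isCompact_polar.inter_right hclosed).exists_forall_le'
    (α := ℝᵒᵈ) (f := fun l => l (barycenter p η))
    (ContinuousEvalConst.continuous_eval_const _).continuousOn hlt
  exact ⟨r, hr, fun l hl => hle l ⟨fun v => (hl v).1, fun v hv => (hl v).2.mpr hv⟩⟩

theorem IsPolytopal.eventually_exists_supportsAt_insertNone [Finite V] (hK : IsPolytopal K p)
    (hη : ¬ η ⊆ σ) (hση : K.IsSimplex (η ∪ σ)) : ∀ᶠ c : ℝ in 𝓝[>] 1,
      ∃ l : E →L[ℝ] ℝ, SupportsAt (stellarVertex p η c) l (Finset.insertNone σ) := by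
  have hne : η.Nonempty := Finset.nonempty_iff_ne_empty.mpr fun h => hη (h ▸ σ.empty_subset)
  obtain ⟨l, hl⟩ := (hK.isSimplex_iff _).mp hση
  obtain ⟨m, hmη, hmσ, hpos⟩ := hK.exists_apply_barycenter_eq_one hση hη
  filter_upwards [self_mem_nhdsWithin, tendsto_one_sub_inv_nhdsGT_one.eventually
    (hl.eventually_sub_smul Finset.subset_union_right hmσ hpos)] with c hc hsupp
  refine ⟨_, supportsAt_stellarVertex_insertNone.mpr ⟨?_, hsupp⟩⟩
  have hlη : l (barycenter p η) = 1 := apply_barycenter_eq_one hne fun v hv =>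
    (hl v).2.mpr (Finset.mem_union_left σ hv)
  have hc0 : c ≠ 0 := (one_pos.trans hc).ne'
  simp [hlη, hmη, hc0]

theorem IsPolytopal.eventually_isSimplex_subdivide_insertNone_iff [Finite V]
    [FiniteDimensional ℝ E] (hK : IsPolytopal K p) (hη : η.Nonempty) (σ : Finset V) :
    ∀ᶠ c : ℝ in 𝓝[>] 1, ((K.subdivide η).IsSimplex (Finset.insertNone σ) ↔
      ∃ l : E →L[ℝ] ℝ, SupportsAt (stellarVertex p η c) l (Finset.insertNone σ)) := by
  rw [isSimplex_subdivide_insertNone]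
  by_cases hησ : η ⊆ σ
  · filter_upwards [self_mem_nhdsWithin] with c hc
    refine iff_of_false (fun h => h.1 hησ) fun ⟨l, hl⟩ => ?_
    obtain ⟨hnone, hl⟩ := supportsAt_stellarVertex_insertNone.mp hl
    rw [apply_barycenter_eq_one hη fun v hv => (hl v).2.mpr (hησ hv), mul_one] at hnone
    exact hc.ne' hnone
  by_cases hK' : K.IsSimplex (η ∪ σ)
  · filter_upwards [hK.eventually_exists_supportsAt_insertNone hησ hK'] with c hc
      using iff_of_true ⟨hησ, hK'⟩ hc
  · obtain ⟨r, hr, hle⟩ := hK.exists_lt_one_forall_apply_barycenter_le hη hK'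
    filter_upwards [self_mem_nhdsWithin, eventually_mul_lt_one hr] with c hc hcr
    refine iff_of_false (fun h => hK' h.2) fun ⟨l, hl⟩ => ?_
    obtain ⟨hnone, hl⟩ := supportsAt_stellarVertex_insertNone.mp hl
    exact (((mul_le_mul_of_nonneg_left (hle l hl) (one_pos.trans hc).le).trans_lt hcr)).ne hnone

theorem IsPolytopal.exists_eqOn_stellarVertex (hK : IsPolytopal K p) (hη : η.Nonempty) {c : ℝ}
    (hc : c ≠ 0) {ρ : Finset (Option V)} (hρ : (K.subdivide η).IsSimplex ρ) (g : Option V → ℝ) :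
    ∃ l : E →L[ℝ] ℝ, ∀ v ∈ ρ, l (stellarVertex p η c v) = g v := by
  obtain ⟨σ, rfl | rfl⟩ := exists_eq_map_some_or_eq_insertNone ρ
  · obtain ⟨l, hl⟩ := hK.exists_eqOn σ ((isSimplex_subdivide_map_some hη).mp hρ).2
      fun v => g (some v)
    exact ⟨l, by simpa [stellarVertex] using hl⟩
  · obtain ⟨hησ, hσ⟩ := isSimplex_subdivide_insertNone.mp hρ
    obtain ⟨l, hl⟩ := hK.exists_eqOn σ (hσ.mono Finset.subset_union_right) fun v => g (some v)
    obtain ⟨m, hmη, hmσ, -⟩ := hK.exists_apply_barycenter_eq_one hσ hησ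
    refine ⟨l + (g none / c - l (barycenter p η)) • m, ?_⟩
    rw [Finset.forall_mem_insertNone]
    simp +contextual [stellarVertex, hmη, hmσ, hl, mul_div_cancel₀ _ hc]

theorem IsPolytopal.exists_subdivide [Finite V] [FiniteDimensional ℝ E] (hK : IsPolytopal K p)
    (hη : K.IsSimplex η) (hcard : 1 < η.card) :
    ∃ q : Option V → E, IsPolytopal (K.subdivide η) q := by
  have hne : η.Nonempty := Finset.card_pos.mp (one_pos.trans hcard)
  have hsub {σ : Finset V} (hσ : σ.card ≤ 1) : ¬ η ⊆ σ := fun h =>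
    (hcard.trans_le (Finset.card_le_card h)).not_ge hσ
  have hiff : ∀ᶠ c : ℝ in 𝓝[>] 1, ∀ ρ, (K.subdivide η).IsSimplex ρ ↔
      ∃ l : E →L[ℝ] ℝ, SupportsAt (stellarVertex p η c) l ρ := by
    refine eventually_all.mpr fun ρ => ?_
    obtain ⟨σ, rfl | rfl⟩ := exists_eq_map_some_or_eq_insertNone ρ
    · exact hK.eventually_isSimplex_subdivide_map_some_iff hne σ
    · exact hK.eventually_isSimplex_subdivide_insertNone_iff hne σ
  obtain ⟨c, hc, hiff⟩ := (eventually_mem_nhdsWithin.and hiff).exists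
  refine ⟨stellarVertex p η c, fun l hl => hK.eq_zero_of_nonpos l fun v => hl (some v), ?_, hiff,
    fun ρ hρ => hK.exists_eqOn_stellarVertex hne (one_pos.trans hc).ne' hρ⟩
  rintro (_ | v)
  · exact isSimplex_subdivide_insertNone (σ := ∅).mpr ⟨hsub (by simp), by simpa using hη⟩
  · exact (isSimplex_subdivide_map_some hne).mpr ⟨hsub (σ := {v}) (by simp),
      hK.isSimplex_singleton v⟩

end Subdivision

section Convex

variable {V E : Type*} [NormedAddCommGroup E] [NormedSpace ℝ E]

theorem eq_zero_of_forall_le_of_mem_interior {s : Set E} {x : E} (hx : x ∈ interior s)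
    {l : E →L[ℝ] ℝ} (hl : ∀ y ∈ s, l y ≤ l x) : l = 0 :=
  ((isMaxOn_iff.mpr hl).isLocalMax (mem_interior_iff_mem_nhds.mp hx)).hasFDerivAt_eq_zero
    l.hasFDerivAt

theorem apply_le_of_mem_convexHull {s : Set E} {l : E →L[ℝ] ℝ} {c : ℝ} (hl : ∀ x ∈ s, l x ≤ c)
    {y : E} (hy : y ∈ convexHull ℝ s) : l y ≤ c :=
  convexHull_min (t := {x | l x ≤ c}) hl
    (convex_halfSpace_le (l : E →ₗ[ℝ] ℝ).isLinear c) hy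

theorem eq_zero_of_forall_apply_le {p : V → E} {x₀ : E}
    (hx₀ : x₀ ∈ interior (convexHull ℝ (Set.range p))) {l : E →L[ℝ] ℝ}
    (hl : ∀ v, l (p v) ≤ l x₀) : l = 0 :=
  eq_zero_of_forall_le_of_mem_interior hx₀ fun _ =>
    apply_le_of_mem_convexHull (Set.forall_mem_range.mpr hl)

theorem nonempty_of_mem_interior_convexHull_range {p : V → E} {x₀ : E}
    (hx₀ : x₀ ∈ interior (convexHull ℝ (Set.range p))) : Nonempty V :=
  Set.range_nonempty_iff_nonempty.mp (convexHull_nonempty_iff.mp ⟨x₀, interior_subset hx₀⟩)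

/- Translating an interior point to the origin turns every supporting hyperplane of a proper face
into a hyperplane `l = 1`. -/
theorem exists_supportsAt_sub_iff [Fintype V] {p : V → E} {x₀ : E}
    (hx₀ : x₀ ∈ interior (convexHull ℝ (Set.range p))) {σ : Finset V} :
    (∃ l : E →L[ℝ] ℝ, SupportsAt (fun v => p v - x₀) l σ) ↔
      σ ≠ Finset.univ ∧ ∃ (l : E →L[ℝ] ℝ) (c : ℝ), ∀ v, l (p v) ≤ c ∧ (l (p v) = c ↔ v ∈ σ) := by
  have : Nonempty V := nonempty_of_mem_interior_convexHull_range hx₀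
  simp only [SupportsAt, map_sub, sub_le_iff_le_add, sub_eq_iff_eq_add]
  constructor
  · rintro ⟨l, hl⟩
    refine ⟨?_, l, 1 + l x₀, hl⟩
    rintro rfl
    have hval (v : V) : l (p v) = 1 + l x₀ := (hl v).2.mpr (Finset.mem_univ v)
    have hneg : -l = 0 := eq_zero_of_forall_apply_le hx₀ fun v => by
      simp only [neg_apply, hval]
      linarith
    simpa [neg_eq_zero.mp hneg] using hval (Classical.arbitrary V)
  · rintro ⟨hσ, l, c, hl⟩
    have hle : l x₀ ≤ c :=
      apply_le_of_mem_convexHull (Set.forall_mem_range.mpr fun v => (hl v).1)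
        (interior_subset hx₀)
    have hlt : 0 < c - l x₀ := sub_pos.mpr <| hle.lt_of_ne fun heq => hσ <| by
      have hzero : l = 0 := eq_zero_of_forall_apply_le hx₀ fun v => heq ▸ (hl v).1
      ext v
      simpa [hzero, ← heq] using (hl v).2
    refine ⟨(c - l x₀)⁻¹ • l, fun v => ?_⟩
    rw [← (hl v).2, smul_apply, smul_apply, smul_eq_mul, smul_eq_mul, ← sub_le_iff_le_add,
      ← sub_eq_iff_eq_add, ← mul_sub, inv_mul_le_one₀ hlt, inv_mul_eq_one₀ hlt.ne',
      sub_le_sub_iff_right, eq_comm, sub_left_inj]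
    exact ⟨(hl v).1, Iff.rfl⟩

theorem mem_extremePoints_convexHull_range_iff [Finite V] {p : V → E} (hp : Function.Injective p)
    {v : V} : p v ∈ (convexHull ℝ (Set.range p)).extremePoints ℝ ↔
      ∃ l : E →L[ℝ] ℝ, ∀ w ≠ v, l (p w) < l (p v) := by
  constructor
  · intro hv
    rw [(convex_convexHull ℝ _).mem_extremePoints_iff_mem_sdiff_convexHull_sdiff] at hv
    have hnot : p v ∉ convexHull ℝ (Set.range p \ {p v}) := fun h =>
      hv.2 (convexHull_mono (Set.sdiff_subset_sdiff_left (subset_convexHull ℝ _)) h)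
    obtain ⟨l, u, hl, hu⟩ := geometric_hahn_banach_closed_point (convex_convexHull ℝ _)
      (((Set.finite_range p).subset Set.sdiff_subset).isClosed_convexHull ℝ) hnot
    exact ⟨l, fun w hw =>
      (hl _ (subset_convexHull ℝ _ ⟨⟨w, rfl⟩, fun h => hw (hp h)⟩)).trans hu⟩
  · rintro ⟨l, hl⟩
    set P := convexHull ℝ (Set.range p)
    have hexp : IsExposed ℝ P (l.toExposed P) := ContinuousLinearMap.toExposed.isExposed
    have hle : ∀ y ∈ P, l y ≤ l (p v) := fun y =>
      apply_le_of_mem_convexHull (Set.forall_mem_range.mpr fun w =>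
        (eq_or_ne w v).elim (fun h => h ▸ le_rfl) fun h => (hl w h).le)
    have hpv : p v ∈ P := subset_convexHull ℝ _ ⟨v, rfl⟩
    obtain ⟨y, hy⟩ := (hexp.isCompact ((Set.finite_range p).isCompact_convexHull ℝ)
      ).extremePoints_nonempty ⟨p v, hpv, hle⟩
    have hyP : y ∈ P.extremePoints ℝ := hexp.isExtreme.extremePoints_subset_extremePoints hy
    obtain ⟨w, rfl⟩ := extremePoints_convexHull_subset hyP
    obtain rfl : w = v := by
      by_contra hwv
      exact (hl w hwv).not_ge (hy.1.2 _ hpv)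
    exact hyP

theorem linearIndependent_iff_forall_exists_apply_eq {ι : Type*} [FiniteDimensional ℝ E]
    {q : ι → E} :
    LinearIndependent ℝ q ↔ ∀ g : ι → ℝ, ∃ l : E →L[ℝ] ℝ, ∀ i, l (q i) = g i := by
  classical
  constructor
  · intro hq g
    obtain ⟨l, hl⟩ := ((Module.Basis.span hq).constr ℝ g).exists_extend
    refine ⟨LinearMap.toContinuousLinearMap l, fun i => ?_⟩
    have hi := LinearMap.congr_fun hl (Module.Basis.span hq i)
    rwa [Module.Basis.constr_basis, LinearMap.comp_apply, Submodule.subtype_apply,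
      Module.Basis.span_apply] at hi
  · intro h
    refine linearIndependent_iff'.mpr fun s w hw i hi => ?_
    obtain ⟨l, hl⟩ := h (Pi.single i 1)
    simpa [hl, Pi.single_apply, hi] using congrArg l hw

theorem affineIndependent_iff_linearIndependent_of_apply_eq_one {ι : Type*} {q : ι → E}
    {l : E →L[ℝ] ℝ} (hl : ∀ i, l (q i) = 1) :
    AffineIndependent ℝ q ↔ LinearIndependent ℝ q := by
  refine ⟨fun h => ?_, LinearIndependent.affineIndependent ℝ⟩
  refine linearIndependent_iff'.mpr fun s w hw => affineIndependent_iff.mp h s w ?_ hw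
  simpa [hl] using congrArg l hw

theorem SupportsAt.affineIndependent_iff [FiniteDimensional ℝ E] {p : V → E} {x₀ : E}
    {l : E →L[ℝ] ℝ} {σ : Finset V} (hl : SupportsAt (fun v => p v - x₀) l σ) :
    AffineIndependent ℝ (fun v : σ => p v) ↔
      ∀ g : V → ℝ, ∃ m : E →L[ℝ] ℝ, ∀ v ∈ σ, m (p v - x₀) = g v := by
  classical
  have hq (v : σ) : l (p v - x₀) = 1 := (hl v).2.mpr v.2
  have htranslate : AffineIndependent ℝ (fun v : σ => p v - x₀) ↔
      AffineIndependent ℝ (fun v : σ => p v) :=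
    (AffineEquiv.vaddConst ℝ x₀).symm.affineIndependent_iff
  rw [← htranslate, affineIndependent_iff_linearIndependent_of_apply_eq_one hq,
    linearIndependent_iff_forall_exists_apply_eq]
  refine ⟨fun h g => ?_, fun h g => ?_⟩
  · obtain ⟨m, hm⟩ := h fun v => g v
    exact ⟨m, fun v hv => hm ⟨v, hv⟩⟩
  · obtain ⟨m, hm⟩ := h fun v => if hv : v ∈ σ then g ⟨v, hv⟩ else 0
    exact ⟨m, fun v => (hm v v.2).trans (dif_pos v.2)⟩

namespace IsPolytopal

variable {K : PreAbstractSimplicialComplex V} {p : V → E}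

theorem nonempty [Nontrivial E] (hK : IsPolytopal K p) : Nonempty V := by
  obtain ⟨x, hx⟩ := exists_ne (0 : E)
  obtain ⟨l, hl⟩ := SeparatingDual.exists_ne_zero (R := ℝ) hx
  by_contra hV
  exact hl (by simp [hK.eq_zero_of_nonpos l fun v => absurd ⟨v⟩ hV])

theorem exists_forall_apply_lt (hK : IsPolytopal K p) (v : V) :
    ∃ l : E →L[ℝ] ℝ, ∀ w ≠ v, l (p w) < l (p v) := by
  obtain ⟨l, hl⟩ := (hK.isSimplex_iff {v}).mp (hK.isSimplex_singleton v)
  have hv : l (p v) = 1 := (hl v).2.mpr (Finset.mem_singleton_self v)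
  exact ⟨l, fun w hw => hv ▸ (hl w).1.lt_of_ne fun h =>
    hw (Finset.mem_singleton.mp ((hl w).2.mp h))⟩

theorem injective (hK : IsPolytopal K p) : Function.Injective p := by
  intro v w hvw
  by_contra hne
  obtain ⟨l, hl⟩ := hK.exists_forall_apply_lt w
  exact (hl v hne).ne (congrArg l hvw)

theorem zero_mem_interior [Finite V] [FiniteDimensional ℝ E] [Nontrivial E]
    (hK : IsPolytopal K p) : (0 : E) ∈ interior (convexHull ℝ (Set.range p)) := by
  have : Nonempty V := hK.nonempty
  obtain ⟨r, hr, hnorm⟩ := hK.exists_pos_mul_norm_le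
  refine mem_interior_iff_mem_nhds.mpr (Filter.mem_of_superset (Metric.ball_mem_nhds _ hr) ?_)
  intro x hx
  by_contra hxP
  obtain ⟨l, u, hl, hu⟩ := geometric_hahn_banach_closed_point (convex_convexHull ℝ (Set.range p))
    ((Set.finite_range p).isClosed_convexHull ℝ) hxP
  obtain ⟨v, hv⟩ := hnorm l
  have hlt : l (p v) < l x := (hl _ (subset_convexHull ℝ _ ⟨v, rfl⟩)).trans hu
  have hle : l x ≤ ‖l‖ * r := (le_abs_self _).trans
    ((l.le_opNorm x).trans (mul_le_mul_of_nonneg_left (mem_ball_zero_iff.mp hx).le (norm_nonneg l)))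
  linarith

theorem isConvexSphereTriangulation [Fintype V] {n : ℕ} {p : V → EuclideanSpace ℝ (Fin (n + 1))}
    (hK : IsPolytopal K p) : K.IsConvexSphereTriangulation n := by
  have h0 := hK.zero_mem_interior
  refine ⟨p, hK.injective, ⟨0, h0⟩, extremePoints_convexHull_subset.antisymm ?_, fun σ => ?_,
    fun σ hσ => ?_⟩
  · rintro _ ⟨v, rfl⟩
    exact (mem_extremePoints_convexHull_range_iff hK.injective).mpr (hK.exists_forall_apply_lt v)
  · rw [mem_faces_iff, hK.isSimplex_iff, ← exists_supportsAt_sub_iff h0]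
    simp only [sub_zero]
  · obtain ⟨l, hl⟩ := (hK.isSimplex_iff σ).mp (mem_faces_iff.mp hσ).2
    rw [SupportsAt.affineIndependent_iff (x₀ := 0) (l := l) (by simpa only [sub_zero] using hl)]
    simpa only [sub_zero] using hK.exists_eqOn σ (mem_faces_iff.mp hσ).2

end IsPolytopal

theorem singleton_ne_univ_of_mem_interior_convexHull_range [Nontrivial E] [Fintype V] {p : V → E}
    {x₀ : E} (hx₀ : x₀ ∈ interior (convexHull ℝ (Set.range p))) (v : V) :
    {v} ≠ (Finset.univ : Finset V) := by
  intro h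
  have hrange : Set.range p ⊆ {p v} := by
    rintro _ ⟨w, rfl⟩
    exact congrArg p (Finset.mem_singleton.mp (h.ge (Finset.mem_univ w)))
  have hmem := interior_mono (convexHull_min hrange (convex_singleton _)) hx₀
  rw [interior_singleton] at hmem
  exact hmem

theorem exists_isPolytopal_of_isConvexSphereTriangulation [Fintype V]
    {K : PreAbstractSimplicialComplex V} {n : ℕ} (hK : K.IsConvexSphereTriangulation n) :
    ∃ p : V → EuclideanSpace ℝ (Fin (n + 1)), IsPolytopal K p := by
  obtain ⟨p, hinj, ⟨x₀, hx₀⟩, hext, hfaces, hind⟩ := hK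
  have hsimplex (σ : Finset V) : K.IsSimplex σ ↔
      ∃ l : EuclideanSpace ℝ (Fin (n + 1)) →L[ℝ] ℝ, SupportsAt (fun v => p v - x₀) l σ := by
    rcases σ.eq_empty_or_nonempty with rfl | hne
    · exact iff_of_true (isSimplex_empty K) ⟨0, by simp [SupportsAt]⟩
    · rw [exists_supportsAt_sub_iff hx₀, ← and_iff_right (b := K.IsSimplex σ) hne,
        ← mem_faces_iff, hfaces, and_iff_right hne]
  refine ⟨fun v => p v - x₀, fun l hl => ?_, fun v => ?_, hsimplex, fun σ hσ g => ?_⟩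
  · exact eq_zero_of_forall_apply_le hx₀ fun v => by simpa using hl v
  · obtain ⟨l, hl⟩ := (mem_extremePoints_convexHull_range_iff hinj).mp (hext.ge ⟨v, rfl⟩)
    refine singleton_mem_faces_iff.mp ((hfaces {v}).mpr ⟨Finset.singleton_nonempty v,
      singleton_ne_univ_of_mem_interior_convexHull_range hx₀ v, l, l (p v), fun w => ?_⟩)
    rw [Finset.mem_singleton]
    rcases eq_or_ne w v with rfl | hw
    · simp
    · exact ⟨(hl w hw).le, iff_of_false (hl w hw).ne hw⟩
  · rcases σ.eq_empty_or_nonempty with rfl | hne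
    · exact ⟨0, by simp⟩
    · obtain ⟨l, hl⟩ := (hsimplex σ).mp hσ
      exact hl.affineIndependent_iff.mp (hind σ (mem_faces_iff.mpr ⟨hne, hσ⟩)) g

end Convex

section UnitSphere

variable {V E F : Type*} [NormedAddCommGroup E] [NormedSpace ℝ E] [NormedAddCommGroup F]
  [NormedSpace ℝ F]

theorem nonempty_homeomorph_frontier_sphere {s : Set E} (hs : Convex ℝ s)
    (hint : (interior s).Nonempty) (hbdd : Bornology.IsBounded s) :
    Nonempty (frontier s ≃ₜ Metric.sphere (0 : E) 1) := by
  obtain ⟨h, -, -, hfrontier⟩ :=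
    exists_homeomorph_image_interior_closure_frontier_eq_unitBall hs hint hbdd
  exact ⟨(h.image _).trans (.setCongr hfrontier)⟩

theorem nonempty_homeomorph_sphere_of_finrank_eq [FiniteDimensional ℝ E] [FiniteDimensional ℝ F]
    (h : Module.finrank ℝ E = Module.finrank ℝ F) :
    Nonempty (Metric.sphere (0 : E) 1 ≃ₜ Metric.sphere (0 : F) 1) := by
  obtain ⟨e⟩ := FiniteDimensional.nonempty_continuousLinearEquiv_of_finrank_eq (𝕜 := ℝ) h
  have hfrontier : e.toHomeomorph '' Metric.sphere 0 1 = frontier (e '' Metric.closedBall 0 1) := by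
    rw [← frontier_closedBall 0 one_ne_zero, e.toHomeomorph.image_frontier]
    rfl
  have hint : (interior (e '' Metric.closedBall (0 : E) 1)).Nonempty := by
    refine Set.Nonempty.mono (e.toHomeomorph.image_interior _).subset (Set.Nonempty.image _ ?_)
    exact (Metric.nonempty_ball.mpr one_pos).mono Metric.ball_subset_interior_closedBall
  obtain ⟨f⟩ := nonempty_homeomorph_frontier_sphere
    ((convex_closedBall (0 : E) 1).linear_image (e : E →ₗ[ℝ] F)) hint
    ((isCompact_closedBall (0 : E) 1).image e.continuous).isBounded
  exact ⟨(e.toHomeomorph.image _).trans ((Homeomorph.setCongr hfrontier).trans f)⟩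

/-- The extension of a map on the unit sphere that is homogeneous of degree one on rays, used to
pass from a homeomorphism of a sphere with a realization to one of the cones over them. -/
noncomputable def radialExtension (f : Metric.sphere (0 : E) 1 → F) (y : E) : F :=
  ‖y‖ • Function.extend Subtype.val f 0 (‖y‖⁻¹ • y)

theorem radialExtension_smul (f : Metric.sphere (0 : E) 1 → F) (u : Metric.sphere (0 : E) 1)
    {c : ℝ} (hc : 0 ≤ c) : radialExtension f (c • (u : E)) = c • f u := by
  rcases hc.eq_or_lt with rfl | hc
  · simp [radialExtension]
  · have hnorm : ‖c • (u : E)‖ = c := by simp [norm_smul, hc.le]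
    rw [radialExtension, hnorm, inv_smul_smul₀ hc.ne', Subtype.val_injective.extend_apply]

theorem exists_eq_norm_smul_sphere [Nontrivial E] (y : E) :
    ∃ u : Metric.sphere (0 : E) 1, y = ‖y‖ • (u : E) := by
  rcases eq_or_ne y 0 with rfl | hy
  · obtain ⟨u, hu⟩ := NormedSpace.sphere_nonempty (x := (0 : E)) |>.mpr zero_le_one
    exact ⟨⟨u, hu⟩, by simp⟩
  · exact ⟨⟨‖y‖⁻¹ • y, by simp [norm_smul, hy]⟩, by simp [hy]⟩

theorem continuous_radialExtension [ProperSpace E] [Nontrivial E]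
    {f : Metric.sphere (0 : E) 1 → F} (hf : Continuous f) : Continuous (radialExtension f) := by
  refine continuous_iff_continuousAt.mpr fun y => ?_
  rcases eq_or_ne y 0 with rfl | hy
  · obtain ⟨C, hC⟩ := (isCompact_range hf).isBounded.exists_norm_le
    have hzero : radialExtension f 0 = 0 := by simp [radialExtension]
    rw [ContinuousAt, hzero]
    refine squeeze_zero_norm (a := fun y => ‖y‖ * C) (fun y => ?_) ?_
    · obtain ⟨u, hu⟩ := exists_eq_norm_smul_sphere y
      nth_rewrite 1 [hu]
      rw [radialExtension_smul f u (norm_nonneg y), norm_smul, norm_norm]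
      exact mul_le_mul_of_nonneg_left (hC _ ⟨u, rfl⟩) (norm_nonneg y)
    · simpa using (continuous_norm.mul_const C).tendsto (0 : E)
  · refine ContinuousOn.continuousAt (s := {0}ᶜ) ?_ (isOpen_ne.mem_nhds hy)
    rw [continuousOn_iff_continuous_domRestrict]
    have hpolar : Continuous fun y : ({0}ᶜ : Set E) => ‖y.1‖ • f (homeomorphUnitSphereProd E y).1 :=
      (by fun_prop : Continuous fun y : ({0}ᶜ : Set E) => ‖y.1‖).smul
        (hf.comp (continuous_fst.comp (homeomorphUnitSphereProd E).continuous))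
    refine hpolar.congr fun y => ?_
    rw [← radialExtension_smul f _ (norm_nonneg y.1), homeomorphUnitSphereProd_apply_fst_coe,
      smul_inv_smul₀ (norm_ne_zero_iff.mpr y.2)]
    rfl

end UnitSphere

section Cone

variable {V W E : Type*} [NormedAddCommGroup E] [NormedSpace ℝ E]
  {K : PreAbstractSimplicialComplex V} {L : PreAbstractSimplicialComplex W}

/-- The cone over the geometric realization: nonnegative weights, of any sum, on the vertices of a
simplex. -/
def cone (K : PreAbstractSimplicialComplex V) : Set (V → ℝ) :=
  {x | (∀ v, 0 ≤ x v) ∧ ∃ σ, K.IsSimplex σ ∧ ∀ v ∉ σ, x v = 0}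

theorem mem_realization_iff [Fintype V] {x : V → ℝ} :
    x ∈ K.realization ↔ x ∈ cone K ∧ ∑ v, x v = 1 := by
  constructor
  · rintro ⟨⟨hnonneg, hsum⟩, σ, hσ, hx⟩
    exact ⟨⟨hnonneg, σ, Or.inr hσ, hx⟩, hsum⟩
  · rintro ⟨⟨hnonneg, σ, rfl | hσ, hx⟩, hsum⟩
    · simp [hx] at hsum
    · exact ⟨⟨hnonneg, hsum⟩, σ, hσ, hx⟩

theorem smul_mem_cone {x : V → ℝ} (hx : x ∈ cone K) {c : ℝ} (hc : 0 ≤ c) : c • x ∈ cone K := by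
  obtain ⟨hnonneg, σ, hσ, hx⟩ := hx
  exact ⟨fun v => mul_nonneg hc (hnonneg v), σ, hσ, fun v hv => by simp [hx v hv]⟩

theorem exists_eq_smul_of_mem_cone [Fintype V] (hK : K.realization.Nonempty) {x : V → ℝ}
    (hx : x ∈ cone K) : ∃ y : K.realization, x = (∑ v, x v) • (y : V → ℝ) := by
  have hnonneg : 0 ≤ ∑ v, x v := Finset.sum_nonneg fun v _ => hx.1 v
  rcases hnonneg.eq_or_lt with hzero | hpos
  · obtain ⟨y, hy⟩ := hK
    refine ⟨⟨y, hy⟩, ?_⟩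
    rw [← hzero, zero_smul]
    ext v
    exact (Finset.sum_eq_zero_iff_of_nonneg fun v _ => hx.1 v).mp hzero.symm v (Finset.mem_univ v)
  · refine ⟨⟨(∑ v, x v)⁻¹ • x, mem_realization_iff.mpr
      ⟨smul_mem_cone hx (inv_nonneg.mpr hnonneg), ?_⟩⟩, (smul_inv_smul₀ hpos.ne' x).symm⟩
    simp [← Finset.mul_sum, hpos.ne']

theorem mem_cone_join {z : V ⊕ W → ℝ} :
    z ∈ cone (K.join L) ↔ z ∘ Sum.inl ∈ cone K ∧ z ∘ Sum.inr ∈ cone L := by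
  constructor
  · rintro ⟨hnonneg, σ, hσ, hz⟩
    rw [isSimplex_join] at hσ
    exact ⟨⟨fun v => hnonneg _, _, hσ.1, fun v hv => hz _ (by simpa using hv)⟩,
      fun v => hnonneg _, _, hσ.2, fun v hv => hz _ (by simpa using hv)⟩
  · rintro ⟨⟨hnonneg, σ, hσ, hz⟩, hnonneg', τ, hτ, hz'⟩
    refine ⟨Sum.rec hnonneg hnonneg', σ.disjSum τ, isSimplex_join.mpr (by simpa using ⟨hσ, hτ⟩), ?_⟩
    rintro (v | w) hv
    exacts [hz v (by simpa using hv), hz' w (by simpa using hv)]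

section RadialExtension

variable [Fintype V] [Nontrivial E] (f : Metric.sphere (0 : E) 1 ≃ₜ K.realization)

theorem radialExtension_mem_cone (y : E) :
    radialExtension (fun u => (f u : V → ℝ)) y ∈ cone K ∧
      ∑ v, radialExtension (fun u => (f u : V → ℝ)) y v = ‖y‖ := by
  obtain ⟨u, hu⟩ := exists_eq_norm_smul_sphere y
  obtain ⟨hcone, hsum⟩ := mem_realization_iff.mp (f u).2
  have hy : radialExtension (fun u => (f u : V → ℝ)) y = ‖y‖ • (f u : V → ℝ) := by
    conv_lhs => rw [hu]
    exact radialExtension_smul _ u (norm_nonneg y)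
  rw [hy]
  exact ⟨smul_mem_cone hcone (norm_nonneg y), by simp [← Finset.mul_sum, hsum]⟩

theorem bijOn_radialExtension :
    Set.BijOn (radialExtension fun u => (f u : V → ℝ)) Set.univ (cone K) := by
  refine ⟨fun y _ => (radialExtension_mem_cone f y).1, fun y _ z _ hyz => ?_, fun x hx => ?_⟩
  · obtain ⟨u, hu⟩ := exists_eq_norm_smul_sphere y
    obtain ⟨w, hw⟩ := exists_eq_norm_smul_sphere z
    have hnorm : ‖y‖ = ‖z‖ := by
      rw [← (radialExtension_mem_cone f y).2, hyz, (radialExtension_mem_cone f z).2]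
    rw [hu, hw, ← hnorm, radialExtension_smul _ u (norm_nonneg y),
      radialExtension_smul _ w (norm_nonneg y)] at hyz
    rw [hu, hw, ← hnorm]
    rcases eq_or_ne ‖y‖ 0 with hzero | hne
    · simp [hzero]
    · rw [f.injective (Subtype.ext (smul_right_injective _ hne hyz))]
  · obtain ⟨u, hu⟩ := NormedSpace.sphere_nonempty (x := (0 : E)) |>.mpr zero_le_one
    obtain ⟨y, hy⟩ := exists_eq_smul_of_mem_cone ⟨_, (f ⟨u, hu⟩).2⟩ hx
    refine ⟨(∑ v, x v) • (f.symm y : E), trivial, ?_⟩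
    rw [radialExtension_smul _ _ (Finset.sum_nonneg fun v _ => hx.1 v), f.apply_symm_apply, ← hy]

end RadialExtension

end Cone

section Sphere

variable {V W E F : Type*} [NormedAddCommGroup E] [NormedAddCommGroup F]
  {K : PreAbstractSimplicialComplex V} {L : PreAbstractSimplicialComplex W}

theorem nonempty_homeomorph_of_bijOn {X Y : Type*} [TopologicalSpace X] [TopologicalSpace Y]
    [T2Space Y] {φ : X → Y} {s : Set X} {t : Set Y} (hs : IsCompact s) (hφ : ContinuousOn φ s)
    (hbij : Set.BijOn φ s t) : Nonempty (s ≃ₜ t) := by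
  have : CompactSpace s := isCompact_iff_compactSpace.mp hs
  exact ⟨Continuous.homeoOfEquivCompactToT2 (f := hbij.equiv φ) (hφ.mapsToRestrict hbij.mapsTo)⟩

/- For the `ℓ¹` norm the vectors `(y, z)` of norm one are those with `‖y‖ + ‖z‖ = 1`, just as the
points of the realization of a join are the pairs of points of the two cones whose weights add up
to one. -/
theorem bijOn_sumElim_sphere_realization [Fintype V] [Fintype W] {G : E → V → ℝ} {H : F → W → ℝ}
    (hG : Set.BijOn G Set.univ (cone K)) (hGsum : ∀ y, ∑ v, G y v = ‖y‖)
    (hH : Set.BijOn H Set.univ (cone L)) (hHsum : ∀ z, ∑ w, H z w = ‖z‖) :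
    Set.BijOn (fun y : WithLp 1 (E × F) => Sum.elim (G y.fst) (H y.snd)) (Metric.sphere 0 1)
      (K.join L).realization := by
  have hsum (y : WithLp 1 (E × F)) :
      ∑ i, Sum.elim (G y.fst) (H y.snd) i = ‖y‖ := by
    simp [hGsum, hHsum, WithLp.prod_norm_eq_of_L1]
  refine ⟨fun y hy => ?_, fun y _ z _ hyz => ?_, fun x hx => ?_⟩
  · rw [mem_realization_iff, mem_cone_join, hsum]
    exact ⟨⟨hG.mapsTo trivial, hH.mapsTo trivial⟩, mem_sphere_zero_iff_norm.mp hy⟩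
  · have hfst : G y.fst = G z.fst := funext fun v => congrFun hyz (.inl v)
    have hsnd : H y.snd = H z.snd := funext fun w => congrFun hyz (.inr w)
    exact (WithLp.ofLp_injective 1) (Prod.ext (hG.injOn trivial trivial hfst)
      (hH.injOn trivial trivial hsnd))
  · rw [mem_realization_iff, mem_cone_join] at hx
    obtain ⟨⟨hinl, hinr⟩, hone⟩ := hx
    obtain ⟨y, -, hy⟩ := hG.surjOn hinl
    obtain ⟨z, -, hz⟩ := hH.surjOn hinr
    have helim : Sum.elim (G y) (H z) = x := by rw [hy, hz, Sum.elim_comp_inl_inr]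
    refine ⟨WithLp.toLp 1 (y, z), mem_sphere_zero_iff_norm.mpr ?_, helim⟩
    rw [← hsum, ← hone]
    exact congrArg (fun x : V ⊕ W → ℝ => ∑ i, x i) helim

theorem isSphereTriangulation_join [Fintype V] [Fintype W] {m n : ℕ}
    (hK : K.IsSphereTriangulation m) (hL : L.IsSphereTriangulation n) :
    (K.join L).IsSphereTriangulation (m + n + 1) := by
  obtain ⟨f⟩ := hK
  obtain ⟨g⟩ := hL
  let E := WithLp 1 (EuclideanSpace ℝ (Fin (m + 1)) × EuclideanSpace ℝ (Fin (n + 1)))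
  have hfinrank :
      Module.finrank ℝ E = Module.finrank ℝ (EuclideanSpace ℝ (Fin (m + n + 1 + 1))) := by
    rw [LinearEquiv.finrank_eq (WithLp.linearEquiv 1 ℝ _), Module.finrank_prod]
    simp only [finrank_euclideanSpace_fin]
    ring
  obtain ⟨e⟩ := nonempty_homeomorph_sphere_of_finrank_eq hfinrank
  have hf := continuous_radialExtension (continuous_subtype_val.comp f.symm.continuous)
  have hg := continuous_radialExtension (continuous_subtype_val.comp g.symm.continuous)
  have hcont : Continuous fun y : E => Sum.elim
      (radialExtension (fun u => (f.symm u : V → ℝ)) y.fst)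
      (radialExtension (fun u => (g.symm u : W → ℝ)) y.snd) :=
    continuous_pi <| Sum.rec
      (fun v => (continuous_apply v).comp (hf.comp (WithLp.continuous_fst 1 _ _)))
      fun w => (continuous_apply w).comp (hg.comp (WithLp.continuous_snd 1 _ _))
  obtain ⟨φ⟩ := nonempty_homeomorph_of_bijOn (isCompact_sphere (0 : E) 1) hcont.continuousOn
    (bijOn_sumElim_sphere_realization (bijOn_radialExtension f.symm)
      (fun y => (radialExtension_mem_cone f.symm y).2) (bijOn_radialExtension g.symm)
      fun z => (radialExtension_mem_cone g.symm z).2)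
  exact ⟨φ.symm.trans e⟩

theorem isCompact_realization [Fintype V] (K : PreAbstractSimplicialComplex V) :
    IsCompact K.realization := by
  have hinter : K.realization =
      stdSimplex ℝ V ∩ ⋃ σ ∈ K.faces, {x | ∀ v, v ∉ σ → x v = 0} := by
    ext x
    simp [realization]
  rw [hinter]
  refine (isCompact_stdSimplex ℝ V).inter_right ((Set.toFinite _).isClosed_biUnion fun σ _ => ?_)
  simp only [Set.ofPred_forall]
  exact isClosed_iInter fun v => isClosed_iInter fun _ => isClosed_eq (by fun_prop) (by fun_prop)

variable [NormedSpace ℝ E]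

theorem convexHull_range_eq_linearCombination_image [Fintype V] (p : V → E) :
    convexHull ℝ (Set.range p) = Fintype.linearCombination ℝ p '' stdSimplex ℝ V := by
  classical
  rw [← convexHull_rangle_single_eq_stdSimplex, LinearMap.image_convexHull, ← Set.range_comp]
  congr 2
  ext v
  simp

theorem eq_zero_of_sum_mul_eq [Fintype V] {x a : V → ℝ} {c : ℝ} (hx : x ∈ stdSimplex ℝ V)
    (ha : ∀ v, a v ≤ c) (hsum : ∑ v, x v * a v = c) {v : V} (hv : a v ≠ c) : x v = 0 := by
  have hzero : ∑ v, x v * (c - a v) = 0 := by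
    simp only [mul_sub, Finset.sum_sub_distrib, ← Finset.sum_mul, hx.2, hsum, one_mul, sub_self]
  have hmul := (Finset.sum_eq_zero_iff_of_nonneg fun v _ =>
    mul_nonneg (hx.1 v) (sub_nonneg.mpr (ha v))).mp hzero v (Finset.mem_univ v)
  exact (mul_eq_zero.mp hmul).resolve_right fun h => hv (sub_eq_zero.mp h).symm

theorem sum_mul_eq_one_of_supportsAt [Fintype V] {p : V → E} {l : E →L[ℝ] ℝ} {σ : Finset V}
    (hl : SupportsAt p l σ) {x : V → ℝ} (hsum : ∑ v, x v = 1) (hx : ∀ v ∉ σ, x v = 0) :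
    ∑ v, x v * l (p v) = 1 := by
  rw [← hsum]
  refine Finset.sum_congr rfl fun v _ => ?_
  by_cases hv : v ∈ σ
  · rw [(hl v).2.mpr hv, mul_one]
  · rw [hx v hv, zero_mul]

namespace IsPolytopal

variable [Fintype V] {p : V → E}

theorem injOn_linearCombination (hK : IsPolytopal K p) :
    Set.InjOn (Fintype.linearCombination ℝ p) K.realization := by
  intro x hx y hy hxy
  obtain ⟨⟨-, σ, hσ, hxσ⟩, hxsum⟩ := mem_realization_iff.mp hx
  simp only [Fintype.linearCombination_apply] at hxy
  obtain ⟨l, hl⟩ := (hK.isSimplex_iff σ).mp hσ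
  have hyl : ∑ v, y v * l (p v) = 1 := by
    rw [← sum_mul_eq_one_of_supportsAt hl hxsum hxσ]
    simpa using congrArg l hxy.symm
  have hyσ : ∀ v ∉ σ, y v = 0 := fun v hv =>
    eq_zero_of_sum_mul_eq hy.1 (fun v => (hl v).1) hyl ((hl v).2.not.mpr hv)
  obtain ⟨m, hm⟩ := hK.exists_eqOn σ hσ (x - y)
  have hsq : ∑ v, (x - y) v * (x - y) v = ∑ v, (x - y) v * m (p v) := by
    refine Finset.sum_congr rfl fun v _ => ?_
    by_cases hv : v ∈ σ
    · rw [hm v hv]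
    · simp [hxσ v hv, hyσ v hv]
  have hzero : ∑ v, (x - y) v * m (p v) = 0 := by
    simpa [sub_mul, Finset.sum_sub_distrib, sub_eq_zero] using congrArg m hxy
  rw [hzero, Finset.sum_mul_self_eq_zero_iff] at hsq
  ext v
  exact sub_eq_zero.mp (hsq v (Finset.mem_univ v))

theorem mapsTo_linearCombination (hK : IsPolytopal K p) :
    Set.MapsTo (Fintype.linearCombination ℝ p) K.realization
      (frontier (convexHull ℝ (Set.range p))) := by
  intro x hx
  rw [((Set.finite_range p).isClosed_convexHull ℝ).frontier_eq]
  refine ⟨convexHull_range_eq_linearCombination_image p ▸ ⟨x, hx.1, rfl⟩, fun hint => ?_⟩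
  obtain ⟨⟨-, σ, hσ, hxσ⟩, hxsum⟩ := mem_realization_iff.mp hx
  obtain ⟨l, hl⟩ := (hK.isSimplex_iff σ).mp hσ
  have hone : l (Fintype.linearCombination ℝ p x) = 1 := by
    simpa [Fintype.linearCombination_apply] using sum_mul_eq_one_of_supportsAt hl hxsum hxσ
  have hzero : l = 0 := eq_zero_of_forall_apply_le hint fun v => hone ▸ (hl v).1
  simp [hzero] at hone

theorem surjOn_linearCombination [FiniteDimensional ℝ E] [Nontrivial E] (hK : IsPolytopal K p) :
    Set.SurjOn (Fintype.linearCombination ℝ p) K.realization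
      (frontier (convexHull ℝ (Set.range p))) := by
  classical
  intro y hy
  rw [((Set.finite_range p).isClosed_convexHull ℝ).frontier_eq] at hy
  obtain ⟨l, hl, hle⟩ := geometric_hahn_banach_of_nonempty_interior_point
    (convex_convexHull ℝ (Set.range p)) hy.2 ⟨0, hK.zero_mem_interior⟩
  have hle (v : V) : l (p v) ≤ l y := hle _ (subset_convexHull ℝ _ ⟨v, rfl⟩)
  have hpos : 0 < l y := by
    by_contra! hnonpos
    exact hl (hK.eq_zero_of_nonpos l fun v => (hle v).trans hnonpos)
  have hsupp : SupportsAt p ((l y)⁻¹ • l) {v | l (p v) = l y} := fun v => by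
    rw [smul_apply, smul_eq_mul, inv_mul_le_one₀ hpos, inv_mul_eq_one₀ hpos.ne', eq_comm,
      Finset.mem_filter_univ]
    exact ⟨hle v, Iff.rfl⟩
  obtain ⟨x, hx, hxy⟩ := (convexHull_range_eq_linearCombination_image p).subset hy.1
  have hsum : ∑ v, x v * l (p v) = l y := by
    simp [← hxy, Fintype.linearCombination_apply]
  refine ⟨x, mem_realization_iff.mpr ⟨⟨hx.1, _, (hK.isSimplex_iff _).mpr ⟨_, hsupp⟩,
    fun v hv => ?_⟩, hx.2⟩, hxy⟩
  exact eq_zero_of_sum_mul_eq hx hle hsum (by simpa using hv)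

theorem isSphereTriangulation {n : ℕ} {p : V → EuclideanSpace ℝ (Fin (n + 1))}
    (hK : IsPolytopal K p) : K.IsSphereTriangulation n := by
  obtain ⟨f⟩ := nonempty_homeomorph_of_bijOn (isCompact_realization K)
    (LinearMap.continuous_of_finiteDimensional _).continuousOn
    ⟨hK.mapsTo_linearCombination, hK.injOn_linearCombination, hK.surjOn_linearCombination⟩
  obtain ⟨g⟩ := nonempty_homeomorph_frontier_sphere (convex_convexHull ℝ (Set.range p))
    ⟨0, hK.zero_mem_interior⟩ ((Set.finite_range p).isCompact_convexHull ℝ).isBounded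
  exact ⟨f.trans g⟩

end IsPolytopal

end Sphere

section ConvexSphere

variable {V W E : Type*} [Fintype V] [Fintype W] [NormedAddCommGroup E] [NormedSpace ℝ E]
  [FiniteDimensional ℝ E] {K : PreAbstractSimplicialComplex V}
  {L : PreAbstractSimplicialComplex W} {m n : ℕ}

theorem IsPolytopal.isConvexSphereTriangulation_of_finrank_eq {p : V → E} (hK : IsPolytopal K p)
    (hn : Module.finrank ℝ E = n + 1) : K.IsConvexSphereTriangulation n :=
  (hK.map (ContinuousLinearEquiv.ofFinrankEq (by simpa using hn))).isConvexSphereTriangulation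

theorem isSphereTriangulation_of_isConvexSphereTriangulation
    (hK : K.IsConvexSphereTriangulation n) : K.IsSphereTriangulation n := by
  obtain ⟨p, hp⟩ := exists_isPolytopal_of_isConvexSphereTriangulation hK
  exact hp.isSphereTriangulation

theorem isConvexSphereTriangulation_join (hK : K.IsConvexSphereTriangulation m)
    (hL : L.IsConvexSphereTriangulation n) :
    (K.join L).IsConvexSphereTriangulation (m + n + 1) := by
  obtain ⟨p, hp⟩ := exists_isPolytopal_of_isConvexSphereTriangulation hK
  obtain ⟨q, hq⟩ := exists_isPolytopal_of_isConvexSphereTriangulation hL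
  refine (hp.join hq).isConvexSphereTriangulation_of_finrank_eq ?_
  simp only [Module.finrank_prod, finrank_euclideanSpace_fin]
  ring

theorem isConvexSphereTriangulation_subdivide [DecidableEq V] {η : Finset V}
    (hK : K.IsConvexSphereTriangulation n) (hη : K.IsSimplex η) (hcard : 1 < η.card) :
    (K.subdivide η).IsConvexSphereTriangulation n := by
  obtain ⟨p, hp⟩ := exists_isPolytopal_of_isConvexSphereTriangulation hK
  obtain ⟨q, hq⟩ := hp.exists_subdivide hη hcard
  exact hq.isConvexSphereTriangulation

theorem isConvexFlagSphere_iff [DecidableEq V] :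
    K.IsConvexFlagSphere n ↔ K.IsFlag ∧ K.IsConvexSphereTriangulation n :=
  and_congr_right' (and_iff_right_of_imp isSphereTriangulation_of_isConvexSphereTriangulation)

theorem isConvexFlagSphere_polygon_five : (polygon 5).IsConvexFlagSphere 1 :=
  isConvexFlagSphere_iff.mpr ⟨isFlag_polygon_five,
    isPolytopal_pentagonVertex.isConvexSphereTriangulation_of_finrank_eq (by simp)⟩

theorem isConvexFlagSphere_zeroSphere : zeroSphere.IsConvexFlagSphere 0 :=
  isConvexFlagSphere_iff.mpr ⟨isFlag_zeroSphere,
    isPolytopal_zeroSphere.isConvexSphereTriangulation_of_finrank_eq (by simp)⟩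

variable [DecidableEq V]

theorem isConvexFlagSphere_join [DecidableEq W] (hK : K.IsConvexFlagSphere m)
    (hL : L.IsConvexFlagSphere n) : (K.join L).IsConvexFlagSphere (m + n + 1) :=
  isConvexFlagSphere_iff.mpr ⟨isFlag_join hK.1 hL.1,
    isConvexSphereTriangulation_join hK.2.2 hL.2.2⟩

theorem isConvexFlagSphere_subdivide {η : Finset V} (hK : K.IsConvexFlagSphere n)
    (hη : K.IsEdge η) : (K.subdivide η).IsConvexFlagSphere n :=
  isConvexFlagSphere_iff.mpr ⟨isFlag_subdivide hK.1 hη,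
    isConvexSphereTriangulation_subdivide hK.2.2 (Or.inr hη.1) (hη.2 ▸ one_lt_two)⟩

end ConvexSphere

theorem exists_isConvexFlagSphere_hasNonrealHRoot_of_le {V : Type} [Fintype V] [DecidableEq V]
    {K : PreAbstractSimplicialComplex V} {m n : ℕ} (hK : K.IsConvexFlagSphere m)
    (hroot : K.HasNonrealHRoot) (hmn : m ≤ n) :
    ∃ (W : Type) (_ : Fintype W) (_ : DecidableEq W) (L : PreAbstractSimplicialComplex W),
      L.IsConvexFlagSphere n ∧ L.HasNonrealHRoot := by
  induction n, hmn using Nat.le_induction with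
  | base => exact ⟨V, _, _, K, hK, hroot⟩
  | succ n _ ih =>
    obtain ⟨W, _, _, L, hL, hLroot⟩ := ih
    exact ⟨W ⊕ Bool, _, _, L.join zeroSphere,
      isConvexFlagSphere_join hL isConvexFlagSphere_zeroSphere, hasNonrealHRoot_join hLroot _⟩

section Pentagons

variable {V : Type*} [Fintype V] {K : PreAbstractSimplicialComplex V}

theorem fPoly_subdivide_eq_comp [DecidableEq V] {η : Finset V} {P : ℤ[X]} (k : ℕ)
    (hK : K.fPoly = P.comp (X + X ^ 2)) (hη : K.IsEdge η)
    (hlink : (K.link η).IsIsomorphic (crossPolytope (2 * k))) :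
    (K.subdivide η).fPoly = (P + X * (1 + 4 * X) ^ k).comp (X + X ^ 2) := by
  have hsq : (1 + 2 * X : ℤ[X]) ^ 2 = 1 + 4 * (X + X ^ 2) := by ring
  rw [fPoly_subdivide_of_isEdge hη, hK, fPoly_eq_of_isIsomorphic hlink, fPoly_crossPolytope,
    pow_mul, hsq]
  simp only [add_comp, mul_comp, pow_comp, X_comp, one_comp, ofNat_comp]
  ring

theorem fPoly_join_polygon_five_eq_comp {P : ℤ[X]} (hK : K.fPoly = P.comp (X + X ^ 2)) :
    (K.join (polygon 5)).fPoly = (P * (1 + 5 * X)).comp (X + X ^ 2) := by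
  rw [fPoly_join, hK, fPoly_polygon_five]
  simp only [add_comp, mul_comp, X_comp, one_comp, ofNat_comp]
  ring

theorem fPoly_subdivide_join_polygon_five {η : Finset (ZMod 5 ⊕ ZMod 5)}
    (hη : ((polygon 5).join (polygon 5)).IsEdge η)
    (hlink : (((polygon 5).join (polygon 5)).link η).IsIsomorphic (polygon 4)) :
    ((((polygon 5).join (polygon 5)).subdivide η).join (polygon 5)).fPoly =
      (Cubic.toPoly ⟨145, 84, 16, 1⟩).comp (X + X ^ 2) := by
  have hpentagon : (polygon 5).fPoly = (1 + 5 * X : ℤ[X]).comp (X + X ^ 2) := by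
    rw [fPoly_polygon_five]
    simp only [add_comp, mul_comp, X_comp, one_comp, ofNat_comp]
    ring
  rw [fPoly_join_polygon_five_eq_comp <| fPoly_subdivide_eq_comp 1
    (fPoly_join_polygon_five_eq_comp hpentagon) hη
    (isIsomorphic_trans hlink isIsomorphic_polygon_four)]
  congr 1
  simp only [Cubic.toPoly, map_ofNat, map_one]
  ring

theorem fPoly_subdivide_eq_comp_cubic [DecidableEq V] {a b c d : ℤ}
    (hK : K.fPoly = (Cubic.toPoly ⟨a, b, c, d⟩).comp (X + X ^ 2)) {θ : Finset V}
    (hθ : K.IsEdge θ) (hlink : (K.link θ).IsIsomorphic (crossPolytope 4)) :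
    (K.subdivide θ).fPoly = (Cubic.toPoly ⟨a + 16, b + 8, c + 1, d⟩).comp (X + X ^ 2) := by
  rw [fPoly_subdivide_eq_comp 2 hK hθ hlink]
  congr 1
  simp only [Cubic.toPoly, map_add, map_ofNat, map_one]
  ring

theorem fPoly_subdivide_subdivide_join_polygon_five {η : Finset (ZMod 5 ⊕ ZMod 5)}
    (hη : ((polygon 5).join (polygon 5)).IsEdge η)
    (hlink : (((polygon 5).join (polygon 5)).link η).IsIsomorphic (polygon 4))
    {θ : Finset (Option (ZMod 5 ⊕ ZMod 5) ⊕ ZMod 5)}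
    (hθ : ((((polygon 5).join (polygon 5)).subdivide η).join (polygon 5)).IsEdge θ)
    (hθlink : (((((polygon 5).join (polygon 5)).subdivide η).join (polygon 5)).link θ).IsIsomorphic
      (crossPolytope 4)) :
    (((((polygon 5).join (polygon 5)).subdivide η).join (polygon 5)).subdivide θ).fPoly =
      (Cubic.toPoly ⟨161, 92, 17, 1⟩).comp (X + X ^ 2) :=
  fPoly_subdivide_eq_comp_cubic (fPoly_subdivide_join_polygon_five hη hlink) hθ hθlink

theorem toPoly_comp_X_add_X_sq (a b c d : ℤ) :
    (Cubic.toPoly ⟨a, b, c, d⟩).comp (X + X ^ 2) =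
      C a * X ^ 6 + C (3 * a) * X ^ 5 + C (3 * a + b) * X ^ 4 + C (a + 2 * b) * X ^ 3 +
        C (b + c) * X ^ 2 + C c * X + C d := by
  simp only [Cubic.toPoly, add_comp, mul_comp, pow_comp, X_comp, C_comp, map_add, map_mul,
    map_ofNat]
  ring

theorem hPoly_of_fPoly_eq_comp_cubic {a b c d : ℤ} (ha : a ≠ 0)
    (hK : K.fPoly = (Cubic.toPoly ⟨a, b, c, d⟩).comp (X + X ^ 2)) :
    K.hPoly = C a * X ^ 3 + C b * X ^ 2 * (1 - X) ^ 2 + C c * X * (1 - X) ^ 4 +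
      C d * (1 - X) ^ 6 := by
  have hf := hK.trans (toPoly_comp_X_add_X_sq a b c d)
  have hrank : K.rank = 6 := by
    rw [rank_eq_natDegree_fPoly, hf]
    compute_degree!
  rw [hPoly_eq_sum_coeff, hrank, hf]
  simp only [Finset.sum_range_succ, Finset.sum_range_zero, coeff_add, coeff_C_mul, coeff_X_pow,
    coeff_X, coeff_C]
  norm_num
  ring

/- The coefficients come from `(1 - t) ^ 2 = (1 + t) ^ 2 - 4 * t`. -/
theorem isGammaPoly_of_fPoly_eq_comp_cubic {a b c d : ℤ} (ha : a ≠ 0) (hd : d ≠ 0)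
    (hK : K.fPoly = (Cubic.toPoly ⟨a, b, c, d⟩).comp (X + X ^ 2)) :
    K.IsGammaPoly
      (Cubic.toPoly ⟨a - 4 * b + 16 * c - 64 * d, b - 8 * c + 48 * d, c - 12 * d, d⟩) := by
  have hh := hPoly_of_fPoly_eq_comp_cubic ha hK
  have hdeg : K.hPoly.natDegree = 6 := by
    rw [hh]
    compute_degree!
  refine ⟨hdeg ▸ Nat.mul_le_mul_left 2 natDegree_cubic_le, fun t ht => ?_⟩
  rw [hdeg, hh]
  simp only [Cubic.toPoly, map_add, map_sub, map_mul, map_pow, map_one, aeval_X, eq_intCast,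
    map_intCast, map_ofNat]
  field_simp
  ring

theorem isGammaPoly_subdivide_join_polygon_five {η : Finset (ZMod 5 ⊕ ZMod 5)}
    (hη : ((polygon 5).join (polygon 5)).IsEdge η)
    (hlink : (((polygon 5).join (polygon 5)).link η).IsIsomorphic (polygon 4)) :
    ((((polygon 5).join (polygon 5)).subdivide η).join (polygon 5)).IsGammaPoly
      (1 + 4 * X + 4 * X ^ 2 + X ^ 3) := by
  convert isGammaPoly_of_fPoly_eq_comp_cubic (by norm_num) one_ne_zero
    (fPoly_subdivide_join_polygon_five hη hlink) using 1
  norm_num [Cubic.toPoly]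
  ring

theorem isConvexFlagSphere_subdivide_join_polygon_five {η : Finset (ZMod 5 ⊕ ZMod 5)}
    (hη : ((polygon 5).join (polygon 5)).IsEdge η) :
    ((((polygon 5).join (polygon 5)).subdivide η).join (polygon 5)).IsConvexFlagSphere 5 :=
  have h := isConvexFlagSphere_polygon_five
  isConvexFlagSphere_join (isConvexFlagSphere_subdivide (isConvexFlagSphere_join h h) hη) h

theorem hasNonrealHRoot_of_fPoly_eq_comp_cubic {a b c d : ℤ} (ha : a ≠ 0)
    (hd : Cubic.discr ⟨a, b, c, d⟩ < 0)
    (hK : K.fPoly = (Cubic.toPoly ⟨a, b, c, d⟩).comp (X + X ^ 2)) : K.HasNonrealHRoot :=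
  have hquad : (X + X ^ 2 : ℤ[X]).natDegree = 2 := by compute_degree!
  hasNonrealHRoot_of_fPoly_eq_comp ha hd (hquad.symm ▸ two_pos) hK

end Pentagons

end FlagSphere

open FlagSphere PreAbstractSimplicialComplex in
theorem corollary3p3p4 :
    -- an edge of the join of two pentagons whose link is a quadrilateral exists
    (∃ η, ((PreAbstractSimplicialComplex.polygon 5).join (.polygon 5)).IsEdge η ∧
      (((PreAbstractSimplicialComplex.polygon 5).join (.polygon 5)).link η).IsIsomorphic
        (.polygon 4)) ∧
    -- any such edge leads to counterexamples in all dimensions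
    (∀ η, ((PreAbstractSimplicialComplex.polygon 5).join (.polygon 5)).IsEdge η →
      (((PreAbstractSimplicialComplex.polygon 5).join (.polygon 5)).link η).IsIsomorphic
        (.polygon 4) →
      ∀ K, K = ((((PreAbstractSimplicialComplex.polygon 5).join (.polygon 5)).subdivide η).join
          (.polygon 5)) →
        K.IsConvexFlagSphere 5 ∧
        K.IsGammaPoly (1 + 4 * Polynomial.X + 4 * Polynomial.X ^ 2 + Polynomial.X ^ 3) ∧
        (∃ θ, K.IsEdge θ ∧ (K.link θ).IsIsomorphic (.crossPolytope 4)) ∧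
        ∀ θ, K.IsEdge θ → (K.link θ).IsIsomorphic (.crossPolytope 4) →
          ((K.subdivide θ).IsConvexFlagSphere 5 ∧
            (K.subdivide θ).HasNonrealHRoot ∧
            (K.subdivide θ).fPoly = 1 + 17 * Polynomial.X + 109 * Polynomial.X ^ 2 +
              345 * Polynomial.X ^ 3 + 575 * Polynomial.X ^ 4 + 483 * Polynomial.X ^ 5 +
              161 * Polynomial.X ^ 6) ∧
          -- the same after a second subdivision
          ((∃ κ, (K.subdivide θ).IsEdge κ ∧
              ((K.subdivide θ).link κ).IsIsomorphic (.crossPolytope 4)) ∧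
            ∀ κ, (K.subdivide θ).IsEdge κ →
              ((K.subdivide θ).link κ).IsIsomorphic (.crossPolytope 4) →
              ((K.subdivide θ).subdivide κ).IsConvexFlagSphere 5 ∧
              ((K.subdivide θ).subdivide κ).HasNonrealHRoot) ∧
          -- joins with arbitrary flag sphere triangulations
          ∀ (W : Type*) [Fintype W] [DecidableEq W] (L : PreAbstractSimplicialComplex W) (k : ℕ),
            L.IsFlag → L.IsSphereTriangulation k →
              ((K.subdivide θ).join L).IsFlag ∧
              ((K.subdivide θ).join L).IsSphereTriangulation (k + 6) ∧
              (L.IsConvexSphereTriangulation k →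
                ((K.subdivide θ).join L).IsConvexSphereTriangulation (k + 6)) ∧
              ((K.subdivide θ).join L).HasNonrealHRoot) ∧
    -- counterexamples in every dimension at least five
    ∀ n : ℕ, 5 ≤ n → ∃ (V : Type) (_ : Fintype V) (_ : DecidableEq V)
      (K : PreAbstractSimplicialComplex V), K.IsConvexFlagSphere n ∧ K.HasNonrealHRoot := by
  have hexists (η) (hη) (hlink) := exists_isEdge_link_subdivide_join_isIsomorphic_crossPolytope
    (K := (polygon 5).join (polygon 5)) (η := η) hη
    (isIsomorphic_trans hlink isIsomorphic_polygon_four)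
  refine ⟨exists_isEdge_link_isIsomorphic_polygon_four, fun η hη hlink K hK => ?_, fun n hn => ?_⟩
  · subst hK
    have hX := isConvexFlagSphere_subdivide_join_polygon_five hη
    refine ⟨hX, isGammaPoly_subdivide_join_polygon_five hη hlink, hexists η hη hlink,
      fun θ hθ hθlink => ?_⟩
    have hX' := isConvexFlagSphere_subdivide hX hθ
    have hf' := fPoly_subdivide_subdivide_join_polygon_five hη hlink hθ hθlink
    have hroot := hasNonrealHRoot_of_fPoly_eq_comp_cubic (by simp) (by simp [Cubic.discr]) hf'
    refine ⟨⟨hX', hroot, ?_⟩, ⟨exists_isEdge_subdivide_link_isIsomorphic hθ hθlink,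
      fun κ hκ hκlink => ⟨isConvexFlagSphere_subdivide hX' hκ, ?_⟩⟩, fun W _ _ L k hL hLs => ?_⟩
    · rw [hf', toPoly_comp_X_add_X_sq]
      norm_num
      ring
    · exact hasNonrealHRoot_of_fPoly_eq_comp_cubic (by simp) (by simp [Cubic.discr])
        (fPoly_subdivide_eq_comp_cubic hf' hκ hκlink)
    · rw [show k + 6 = 5 + k + 1 by lia]
      exact ⟨isFlag_join hX'.1 hL, isSphereTriangulation_join hX'.2.1 hLs,
        isConvexSphereTriangulation_join hX'.2.2, hasNonrealHRoot_join hroot L⟩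
  · obtain ⟨η, hη, hlink⟩ := exists_isEdge_link_isIsomorphic_polygon_four
    obtain ⟨θ, hθ, hθlink⟩ := hexists η hη hlink
    refine exists_isConvexFlagSphere_hasNonrealHRoot_of_le (isConvexFlagSphere_subdivide
      (isConvexFlagSphere_subdivide_join_polygon_five hη) hθ) ?_ hn
    exact hasNonrealHRoot_of_fPoly_eq_comp_cubic (by simp) (by simp [Cubic.discr])
      (fPoly_subdivide_subdivide_join_polygon_five hη hlink hθ hθlink)
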